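/- **Theorem 1.** Let $0\le r\le n$ with $n\ge 1$, let $A=\mathrm{diag}(a_1,\dots,a_r,0,\dots,0)$ be $n\times n$ with distinct nonzero real $a_1,\dots,a_r$, and let $V:\mathbb R\to\mathbb R$ be a continuous function that grows fast enough that all moments of $e^{-V(x)}$ and of $e^{-V(x)+a_jx}$ ($1\le j\le r$) are finite. Let $\pi_k$ be the monic orthogonal polynomials, $\int_{\mathbb R}\pi_k\pi_m e^{-V}dx=0$ for $k\ne m$, let $\kappa_k^{-2}=\int_{\mathbb R}\pi_k^2e^{-V}dx$, and for $x\neq y$ let $$K_0(x,y)=\frac{e^{-V(x)}\kappa_{n-1}^2\big(\pi_n(x)\pi_{n-1}(y)-\pi_{n-1}(x)\pi_n(y)\big)}{x-y}.$$ Let $Z$ be the solution of the following $(r+2)\times(r+2)$ Riemann–Hilbert problem: $Z$ is analytic in $\mathbb C\setminus\mathbb R$ with continuous boundary values $Z_\pm$ on $\mathbb R$ from the upper and lower half planes; $Z_+(x)=Z_-(x)J(x)$ for $x\in\mathbb R$, where $J(x)$ is the identity matrix with its first row replaced by $(1,e^{-V(x)},e^{-V(x)+a_1x},\dots,e^{-V(x)+a_rx})$;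 and $Z(z)=(I+O(z^{-1}))\,\mathrm{diag}(z^n,z^{-n+r},z^{-1},\dots,z^{-1})$ as $z\to\infty$ in $\mathbb C\setminus\mathbb R$. For $x\ne y$ let $$K(x,y)=\frac{e^{-V(x)}}{2\pi i(x-y)}\begin{pmatrix}0&1&e^{a_1y}&\cdots&e^{a_ry}\end{pmatrix}Z_\pm(y)^{-1}Z_\pm(x)\begin{pmatrix}1\\0\\ \vdots\\0\end{pmatrix}.$$ Put $\mathbf t(x)=(\pi_{n-r}(x),\dots,\pi_{n-1}(x))^t$, $\mathbf v(x)=(e^{a_1x},\dots,e^{a_rx})^t$, $\mathbf w(y)=\mathbf v(y)-\int_{\mathbb R}K_0(s,y)\mathbf v(s)\,ds$ and $\mathbf B=\int_{\mathbb R}\mathbf t(s)\mathbf v(s)^te^{-V(s)}ds$. Then: 1. the $r\times r$ matrix $\mathbf B$ is invertible; 2. a solution $Z$ exists if the weight is sufficiently regular, namely if there are $M\in\mathbb R$, $\alpha>0$ and $c>0$ with $c>|a_j|$ for all $j$ such that $e^{-V(x)}\le Me^{-c|x|}$ for all $x$ and $|e^{-V(x)}-e^{-V(y)}|\le M|x-y|^\alpha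 e^{-c|x|}$ whenever $|x-y|\le1$; 3. for every solution $Z$, every choice of the boundary values $Z_\pm$ at $x$ and at $y$, and all real $x\neq y$, $$\big(K(x,y)-K_0(x,y)\big)e^{V(x)}=\mathbf w(y)^t\mathbf B^{-1}\mathbf t(x),$$ and $K$, $K_0$ extend continuously to the diagonal $x=y$, where the same identity holds. -/

import Mathlib

open Filter Topology MeasureTheory Polynomial Matrix

namespace ExternalSource

/-! ### Orthogonal polynomials for the weight `exp (-V)` -/

/-- All moments of the weights `exp (-V x)` and `exp (a_j x - V x)` are finite. -/
def FiniteMoments {r : ℕ} (a : Fin r → ℝ) (V : ℝ → ℝ) : Prop :=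
  ∀ k : ℕ, Integrable (fun x : ℝ => x ^ k * Real.exp (-V x)) ∧
    ∀ j, Integrable (fun x : ℝ => x ^ k * Real.exp (-V x + a j * x))

/-- The bilinear form `⟨p, q⟩ = ∫ p(x) q(x) e^{-V(x)} dx` on real polynomials. -/
noncomputable def ip (V : ℝ → ℝ) (p q : ℝ[X]) : ℝ :=
  ∫ x : ℝ, p.eval x * q.eval x * Real.exp (-V x)

/-- The monic orthogonal polynomials `π_k` with respect to the weight `e^{-V(x)}`, obtained by
applying the Gram-Schmidt process to the monomials. -/
noncomputable def monicOP (V : ℝ → ℝ) (k : ℕ) : ℝ[X] :=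
  X ^ k - ∑ j : Fin k,
    C (ip V (X ^ k) (monicOP V j) / ip V (monicOP V j) (monicOP V j)) * monicOP V j
termination_by k
decreasing_by exact j.2

/-! Helper facts: these polynomials are indeed monic of degree `k` and orthogonal. -/

theorem monicOP_eq (V : ℝ → ℝ) (k : ℕ) : monicOP V k = X ^ k - ∑ j : Fin k,
    C (ip V (X ^ k) (monicOP V j) / ip V (monicOP V j) (monicOP V j)) * monicOP V j := by
  rw [monicOP]

theorem monicOP_monic_natDegree (V : ℝ → ℝ) (k : ℕ) :
    (monicOP V k).Monic ∧ (monicOP V k).natDegree = k := by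
  induction k using Nat.strong_induction_on with
  | _ k ih =>
    have hd : (∑ j : Fin k, C (ip V (X ^ k) (monicOP V j) /
        ip V (monicOP V j) (monicOP V j)) * monicOP V j).degree < (k : WithBot ℕ) := by
      rw [← Polynomial.mem_degreeLT]
      refine Submodule.sum_mem _ fun j _ => Polynomial.mem_degreeLT.2 ?_
      refine (Polynomial.degree_mul_le _ _).trans_lt ((add_le_add degree_C_le le_rfl).trans_lt ?_)
      rw [zero_add]
      rw [Polynomial.degree_eq_natDegree (ih j j.2).1.ne_zero, (ih j j.2).2]
      exact_mod_cast j.2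
    rw [monicOP_eq]
    have hm : (X ^ k - ∑ j : Fin k, C (ip V (X ^ k) (monicOP V j) /
        ip V (monicOP V j) (monicOP V j)) * monicOP V j).Monic :=
      (monic_X_pow k).sub_of_left (by rwa [degree_X_pow])
    refine ⟨hm, ?_⟩
    apply natDegree_eq_of_degree_eq_some
    rw [degree_sub_eq_left_of_degree_lt (by rwa [degree_X_pow]), degree_X_pow]

theorem integrable_eval {V : ℝ → ℝ}
    (h : ∀ k : ℕ, Integrable (fun x : ℝ => x ^ k * Real.exp (-V x))) (p : ℝ[X]) :
    Integrable (fun x : ℝ => p.eval x * Real.exp (-V x)) := by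
  simp only [eval_eq_sum_range, Finset.sum_mul, mul_assoc]
  exact integrable_finsetSum _ fun i _ => (h i).const_mul _

theorem ip_self_pos {V : ℝ → ℝ} (hV : Continuous V)
    (h : ∀ k : ℕ, Integrable (fun x : ℝ => x ^ k * Real.exp (-V x))) {p : ℝ[X]} (hp : p ≠ 0) :
    0 < ip V p p := by
  have hi := integrable_eval h (p * p)
  simp only [eval_mul] at hi
  obtain ⟨x, hx⟩ : ∃ x, p.eval x ≠ 0 := by
    by_contra! hc
    exact hp (Polynomial.funext fun x => by simp [hc x])
  refine integral_pos_of_integrable_nonneg_nonzero (x := x) (by fun_prop) hi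
    (fun x => mul_nonneg (mul_self_nonneg _) (Real.exp_pos _).le) ?_
  exact mul_ne_zero (mul_ne_zero hx hx) (Real.exp_pos _).ne'

theorem ip_monicOP_eq_zero {V : ℝ → ℝ} (hV : Continuous V)
    (h : ∀ k : ℕ, Integrable (fun x : ℝ => x ^ k * Real.exp (-V x))) {m k : ℕ} (hmk : m < k) :
    ip V (monicOP V k) (monicOP V m) = 0 := by
  induction k using Nat.strong_induction_on generalizing m with
  | _ k ih =>
    have hsymm : ∀ p q, ip V p q = ip V q p := fun p q => by simp only [ip, mul_comm (p.eval _)]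
    have hi : ∀ p q : ℝ[X], Integrable (fun x : ℝ => p.eval x * q.eval x * Real.exp (-V x)) :=
      fun p q => by simpa using integrable_eval h (p * q)
    have hz : ∀ i : Fin k, i ≠ ⟨m, hmk⟩ → ip V (monicOP V i) (monicOP V m) = 0 := by
      intro i hne
      rcases lt_or_gt_of_ne (fun e : (i : ℕ) = m => hne (Fin.ext e)) with hlt | hgt
      · rw [hsymm]; exact ih m hmk hlt
      · exact ih i i.2 hgt
    have hexp : ∀ (q : ℝ[X]) (c : Fin k → ℝ), ip V (X ^ k - ∑ j : Fin k, C (c j) * monicOP V j) q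
        = ip V (X ^ k) q - ∑ j : Fin k, c j * ip V (monicOP V j) q := by
      intro q c
      simp only [ip, ← integral_const_mul]
      rw [← integral_finsetSum _ fun i _ => (hi _ _).const_mul _,
        ← integral_sub (hi _ _) (integrable_finsetSum _ fun i _ => (hi _ _).const_mul _)]
      congr 1
      ext x
      simp only [eval_sub, eval_finsetSum, eval_mul, eval_C, sub_mul, Finset.sum_mul, mul_assoc]
    rw [monicOP_eq, hexp, Finset.sum_eq_single ⟨m, hmk⟩ (fun i _ hne => by rw [hz i hne, mul_zero])
      (by simp)]
    rw [div_mul_cancel₀ _ (ip_self_pos hV h (monicOP_monic_natDegree V m).1.ne_zero).ne', sub_self]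

/-- `κ_k ^ 2`, where `κ_k > 0` is the constant that makes `κ_k π_k` orthonormal. -/
noncomputable def kappaSq (V : ℝ → ℝ) (k : ℕ) : ℝ :=
  (ip V (monicOP V k) (monicOP V k))⁻¹

/-- The Christoffel-Darboux kernel `K₀(x, y)` of the weight `e^{-V}` (for `x ≠ y`, `1 ≤ n`). -/
noncomputable def kernelZero (n : ℕ) (V : ℝ → ℝ) (x y : ℝ) : ℝ :=
  Real.exp (-V x) * kappaSq V (n - 1) *
    ((monicOP V n).eval x * (monicOP V (n - 1)).eval y
      - (monicOP V (n - 1)).eval x * (monicOP V n).eval y) / (x - y)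

/-! ### The vectors `t`, `v`, `w` and the matrix `B` -/

/-- `t(x) = (π_{n-r}(x), …, π_{n-1}(x))`. -/
noncomputable def tVec (n r : ℕ) (V : ℝ → ℝ) (x : ℝ) : Fin r → ℝ :=
  fun i => (monicOP V (n - r + i)).eval x

/-- `v(x) = (e^{a_1 x}, …, e^{a_r x})`. -/
noncomputable def vVec {r : ℕ} (a : Fin r → ℝ) (x : ℝ) : Fin r → ℝ :=
  fun j => Real.exp (a j * x)

/-- `w(y) = v(y) - ∫ K₀(s, y) v(s) ds`. -/
noncomputable def wVec {r : ℕ} (n : ℕ) (a : Fin r → ℝ) (V : ℝ → ℝ) (y : ℝ) : Fin r → ℝ :=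
  fun j => vVec a y j - ∫ s : ℝ, kernelZero n V s y * vVec a s j

/-- `B = ∫ t(s) v(s)ᵗ e^{-V(s)} ds`. -/
noncomputable def matB {r : ℕ} (n : ℕ) (a : Fin r → ℝ) (V : ℝ → ℝ) : Matrix (Fin r) (Fin r) ℝ :=
  Matrix.of fun i j => ∫ s : ℝ, tVec n r V s i * vVec a s j * Real.exp (-V s)

/-! ### The Riemann-Hilbert problem for multiple orthogonal polynomials -/

/-- The jump matrix: its first row is `(1, e^{-V}, e^{-V + a_1 x}, …, e^{-V + a_r x})`, its other
rows are those of the identity matrix. -/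
noncomputable def jumpMatrix {r : ℕ} (a : Fin r → ℝ) (V : ℝ → ℝ) (x : ℝ) :
    Matrix (Fin (r + 2)) (Fin (r + 2)) ℂ :=
  Matrix.updateRow 1 0
    (vecCons 1 (vecCons (Real.exp (-V x) : ℂ) fun j => (Real.exp (-V x + a j * x) : ℂ)))

/-- The exponents `(n, -n + r, -1, …, -1)`. -/
def rhpExponent (n r : ℕ) : Fin (r + 2) → ℤ :=
  vecCons (n : ℤ) (vecCons (-(n : ℤ) + r) fun _ => -1)

/-- `Z` solves the Riemann-Hilbert problem, with boundary values `Zp` (from the upper half plane)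
and `Zm` (from the lower half plane). The values of `Z` on the real line are irrelevant. -/
structure IsRHPSolution {r : ℕ} (n : ℕ) (a : Fin r → ℝ) (V : ℝ → ℝ)
    (Z : ℂ → Matrix (Fin (r + 2)) (Fin (r + 2)) ℂ)
    (Zp Zm : ℝ → Matrix (Fin (r + 2)) (Fin (r + 2)) ℂ) : Prop where
  analytic : ∀ i j, DifferentiableOn ℂ (fun z => Z z i j) {z : ℂ | z.im ≠ 0}
  upper : ∀ x : ℝ, Tendsto Z (𝓝[{z : ℂ | 0 < z.im}] (x : ℂ)) (𝓝 (Zp x))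
  lower : ∀ x : ℝ, Tendsto Z (𝓝[{z : ℂ | z.im < 0}] (x : ℂ)) (𝓝 (Zm x))
  jump : ∀ x : ℝ, Zp x = Zm x * jumpMatrix a V x
  /-- `Z(z) = (1 + O(1/z)) diag(z^n, z^{-n+r}, z^{-1}, …, z^{-1})` as `z → ∞` off the real line. -/
  asymptotics : ∀ i j,
    (fun z : ℂ => (Z z * Matrix.diagonal fun k => z ^ (-rhpExponent n r k)) i j
        - (1 : Matrix (Fin (r + 2)) (Fin (r + 2)) ℂ) i j)
      =O[Bornology.cobounded ℂ ⊓ 𝓟 {z : ℂ | z.im ≠ 0}] fun z : ℂ => z⁻¹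

/-- The Daems-Kuijlaars kernel (for `x ≠ y`)
`e^{-V(x)} / (2 π i (x - y)) (0, 1, e^{a_1 y}, …, e^{a_r y}) Z(y)⁻¹ Z(x) (1, 0, …, 0)ᵗ`,
where `P` and `Q` are the boundary values of `Z` used at `y` and at `x`. -/
noncomputable def kernel {r : ℕ} (a : Fin r → ℝ) (V : ℝ → ℝ)
    (P Q : ℝ → Matrix (Fin (r + 2)) (Fin (r + 2)) ℂ) (x y : ℝ) : ℂ :=
  (Real.exp (-V x) : ℂ) / (2 * Real.pi * Complex.I * ((x : ℂ) - y)) *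
    ((vecCons 0 (vecCons 1 fun j => (Real.exp (a j * y) : ℂ))) ⬝ᵥ
      (((P y)⁻¹ * Q x) *ᵥ Pi.single 0 1))

/-- The weight `e^{-V}` is locally Hölder continuous, and it and its local Hölder constants decay
exponentially, at a rate larger than all `|a_j|`. -/
def HolderDecay {r : ℕ} (a : Fin r → ℝ) (V : ℝ → ℝ) : Prop :=
  ∃ M α c : ℝ, 0 < α ∧ 0 < c ∧ (∀ j, |a j| < c) ∧
    (∀ x, Real.exp (-V x) ≤ M * Real.exp (-c * |x|)) ∧
    ∀ x y, |x - y| ≤ 1 →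
      |Real.exp (-V x) - Real.exp (-V y)| ≤ M * |x - y| ^ α * Real.exp (-c * |x|)

end ExternalSource

/-! Invertibility of B. If Bc = 0, choose a polynomial P of degree less than n - r such that f = P +
∑ c_j e^{a_j x} is orthogonal to π_0, …, π_{n-r-1}; the equation Bc = 0 says that f is also
orthogonal to π_{n-r}, …, π_{n-1}. For c ≠ 0, Rolle's theorem gives f fewer than n zeros
(`card_zeros_poly_add_expSum_lt`), so some nonzero polynomial of degree less than n has the sign of
f (`exists_poly_mul_nonneg`). Its pairing with f is then both zero and positive.

The formula. In any solution Z the first column has no jump, hence consists of polynomials of degree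
at most n, and det Z = 1, both by Liouville. Fix ζ off the real line and let φ = (0, 1, e^{a_1 ζ},
…, e^{a_r ζ}) Z(ζ)⁻¹. Then φ times the first column is a polynomial N with N(ζ) = 0, so Q(x) = N(x)
/ (2πi(x - ζ)) is a polynomial of degree less than n. Applied to φ times another column, whose jump
is N times a weight, Cauchy's formula (`integral_jump_div`) gives the moments of Q: ζ^m against
e^{-V} for m < n - r, and e^{a_j ζ} against e^{-V + a_j x}. Since B is invertible, these n
conditions determine Q (`eval_eq_complexKernel`): it is the Christoffel-Darboux kernel plus wᵗB⁻¹t.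
Letting ζ tend to y from either half plane yields the identity for every solution, so uniqueness of
Z is never needed.

Existence. Invertibility of B also makes the same n conditions solvable with arbitrary data
(`exists_poly_moments`). Each row of Z is such a polynomial followed by the Cauchy transforms of its
products with the weights. Hölder continuity and exponential decay give the boundary values
(Plemelj) and a bound on the Cauchy transforms that is uniform up to the real line; prescribed
vanishing moments turn this bound into the decay required at infinity. -/

namespace ExternalSource

/-! ### Orthogonal polynomials and the Christoffel-Darboux formula. -/

section OrthogonalPolynomials

theorem exists_eq_sum_C_mul {R : Type*} [CommRing R] {b : ℕ → R[X]} (hb : ∀ k, (b k).Monic)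
    (hd : ∀ k, (b k).natDegree = k) (n : ℕ) {Q : R[X]} (hQ : Q.degree < n) :
    ∃ γ : ℕ → R, Q = ∑ k ∈ Finset.range n, C (γ k) * b k := by
  nontriviality R
  induction n generalizing Q with
  | zero =>
    refine ⟨0, ?_⟩
    simpa using hQ
  | succ n ih =>
    have h1 : (C (Q.coeff n) * b n).degree < ((n + 1 : ℕ) : WithBot ℕ) := by
      rw [← smul_eq_C_mul]
      refine (degree_smul_le _ _).trans_lt ?_
      rw [degree_eq_natDegree (hb n).ne_zero, hd n]
      exact_mod_cast n.lt_succ_self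
    have h2 : (Q - C (Q.coeff n) * b n).degree < n := by
      rw [degree_lt_iff_coeff_zero]
      intro m hm
      rcases hm.eq_or_lt with rfl | hlt
      · have : (b n).coeff n = 1 := by
          have := (hb n).coeff_natDegree
          rwa [hd n] at this
        simp [this]
      · refine coeff_eq_zero_of_degree_lt ((degree_sub_le _ _).trans_lt ?_)
        exact (max_lt hQ h1).trans_le (by exact_mod_cast hlt)
    obtain ⟨γ, hγ⟩ := ih h2
    refine ⟨fun k => if k = n then Q.coeff n else γ k, ?_⟩
    simp only [Finset.sum_range_succ, if_true]
    rw [eq_comm, ← eq_sub_iff_add_eq, hγ]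
    refine Finset.sum_congr rfl fun k hk => ?_
    rw [if_neg (Finset.mem_range.1 hk).ne]

theorem monicOP_monic (V : ℝ → ℝ) (k : ℕ) : (monicOP V k).Monic :=
  (monicOP_monic_natDegree V k).1

theorem monicOP_natDegree (V : ℝ → ℝ) (k : ℕ) : (monicOP V k).natDegree = k :=
  (monicOP_monic_natDegree V k).2

theorem monicOP_degree (V : ℝ → ℝ) (k : ℕ) : (monicOP V k).degree = k := by
  rw [degree_eq_natDegree (monicOP_monic V k).ne_zero, monicOP_natDegree]

theorem exists_eq_sum_monicOP (V : ℝ → ℝ) (n : ℕ) {Q : ℝ[X]} (hQ : Q.degree < n) :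
    ∃ γ : ℕ → ℝ, Q = ∑ k ∈ Finset.range n, C (γ k) * monicOP V k :=
  exists_eq_sum_C_mul (monicOP_monic V) (monicOP_natDegree V) n hQ

theorem ip_comm (V : ℝ → ℝ) (p q : ℝ[X]) : ip V p q = ip V q p := by
  simp only [ip, mul_comm (p.eval _)]

theorem ip_X_mul (V : ℝ → ℝ) (p q : ℝ[X]) : ip V (X * p) q = ip V p (X * q) := by
  simp only [ip, eval_mul, eval_X]
  congr 1 with x
  ring

variable {V : ℝ → ℝ}

theorem integrable_ip (h : ∀ k : ℕ, Integrable (fun x : ℝ => x ^ k * Real.exp (-V x)))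
    (p q : ℝ[X]) : Integrable (fun x : ℝ => p.eval x * q.eval x * Real.exp (-V x)) := by
  simpa using integrable_eval h (p * q)

theorem ip_add_right (h : ∀ k : ℕ, Integrable (fun x : ℝ => x ^ k * Real.exp (-V x)))
    (p q s : ℝ[X]) : ip V p (q + s) = ip V p q + ip V p s := by
  simp only [ip]
  rw [← integral_add (integrable_ip h _ _) (integrable_ip h _ _)]
  congr 1 with x
  rw [eval_add]; ring

theorem ip_C_mul_right (p q : ℝ[X]) (c : ℝ) : ip V p (C c * q) = c * ip V p q := by
  simp only [ip]
  rw [← integral_const_mul]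
  congr 1 with x
  rw [eval_mul, eval_C]; ring

theorem ip_sum_right (h : ∀ k : ℕ, Integrable (fun x : ℝ => x ^ k * Real.exp (-V x)))
    {ι : Type*} (s : Finset ι) (p : ℝ[X]) (q : ι → ℝ[X]) :
    ip V p (∑ i ∈ s, q i) = ∑ i ∈ s, ip V p (q i) := by
  simp only [ip]
  rw [← integral_finsetSum _ fun i _ => integrable_ip h _ _]
  congr 1 with x
  rw [eval_finsetSum, Finset.mul_sum, Finset.sum_mul]

theorem ip_monicOP_of_ne (hV : Continuous V)
    (h : ∀ k : ℕ, Integrable (fun x : ℝ => x ^ k * Real.exp (-V x))) {m k : ℕ} (hmk : m ≠ k) :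
    ip V (monicOP V k) (monicOP V m) = 0 := by
  rcases lt_or_gt_of_ne hmk with hl | hl
  · exact ip_monicOP_eq_zero hV h hl
  · rw [ip_comm]; exact ip_monicOP_eq_zero hV h hl

theorem ip_monicOP_self_pos (hV : Continuous V)
    (h : ∀ k : ℕ, Integrable (fun x : ℝ => x ^ k * Real.exp (-V x))) (k : ℕ) :
    0 < ip V (monicOP V k) (monicOP V k) :=
  ip_self_pos hV h (monicOP_monic V k).ne_zero

theorem ip_monicOP_of_degree_lt (hV : Continuous V)
    (h : ∀ k : ℕ, Integrable (fun x : ℝ => x ^ k * Real.exp (-V x))) {k : ℕ} {q : ℝ[X]}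
    (hq : q.degree < k) : ip V (monicOP V k) q = 0 := by
  obtain ⟨γ, rfl⟩ := exists_eq_sum_monicOP V k hq
  rw [ip_sum_right h]
  refine Finset.sum_eq_zero fun i hi => ?_
  rw [ip_C_mul_right, ip_monicOP_eq_zero hV h (Finset.mem_range.1 hi), mul_zero]

theorem ip_monicOP_sum (hV : Continuous V)
    (h : ∀ k : ℕ, Integrable (fun x : ℝ => x ^ k * Real.exp (-V x))) {k n : ℕ} (hk : k < n)
    (γ : ℕ → ℝ) : ip V (monicOP V k) (∑ i ∈ Finset.range n, C (γ i) * monicOP V i)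
      = γ k * ip V (monicOP V k) (monicOP V k) := by
  rw [ip_sum_right h, Finset.sum_eq_single k]
  · rw [ip_C_mul_right]
  · intro i _ hi
    rw [ip_C_mul_right, ip_monicOP_of_ne hV h hi, mul_zero]
  · intro hc
    exact absurd (Finset.mem_range.2 hk) hc

theorem degree_X_mul_monicOP_sub (V : ℝ → ℝ) (k : ℕ) :
    (X * monicOP V k - monicOP V (k + 1)).degree < ((k + 1 : ℕ) : WithBot ℕ) := by
  have hm : (X * monicOP V k).Monic := monic_X.mul (monicOP_monic V k)
  have hd : (X * monicOP V k).degree = ((k + 1 : ℕ) : WithBot ℕ) := by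
    rw [degree_mul, degree_X, monicOP_degree]; push_cast; rw [add_comm]
  refine (degree_sub_lt_left ?_ hm.ne_zero ?_).trans_eq hd
  · rw [hd, monicOP_degree]
  · rw [hm.leadingCoeff, (monicOP_monic V _).leadingCoeff]

theorem ip_monicOP_X_mul (hV : Continuous V)
    (h : ∀ k : ℕ, Integrable (fun x : ℝ => x ^ k * Real.exp (-V x))) (k : ℕ) :
    ip V (monicOP V (k + 1)) (X * monicOP V k) = ip V (monicOP V (k + 1)) (monicOP V (k + 1)) := by
  have := ip_monicOP_of_degree_lt hV h (degree_X_mul_monicOP_sub V k)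
  have h2 : X * monicOP V k = (X * monicOP V k - monicOP V (k + 1)) + monicOP V (k + 1) := by ring
  rw [h2, ip_add_right h, this, zero_add]

/-- The three term recurrence. -/
theorem X_mul_monicOP (hV : Continuous V)
    (h : ∀ k : ℕ, Integrable (fun x : ℝ => x ^ k * Real.exp (-V x))) (k : ℕ) :
    ∃ b c : ℝ, X * monicOP V (k + 1) = monicOP V (k + 2) + C b * monicOP V (k + 1)
        + C c * monicOP V k ∧ kappaSq V (k + 1) * c = kappaSq V k := by
  obtain ⟨γ, hγ⟩ := exists_eq_sum_monicOP V (k + 2) (degree_X_mul_monicOP_sub V (k + 1))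
  have hcoef : ∀ i < k + 2, γ i * ip V (monicOP V i) (monicOP V i)
      = ip V (monicOP V i) (X * monicOP V (k + 1)) := by
    intro i hi
    rw [← ip_monicOP_sum hV h hi, ← hγ]
    have := ip_add_right h (monicOP V i) (X * monicOP V (k + 1) - monicOP V (k + 2))
      (monicOP V (k + 2))
    rw [sub_add_cancel, ip_monicOP_of_ne hV h (show k + 2 ≠ i by omega), add_zero] at this
    exact this.symm
  -- The recurrence has three terms because multiplication by X is symmetric and X * π_i has degree
  -- less than k + 1 for i < k.
  have hz : ∀ i < k, γ i = 0 := by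
    intro i hi
    have h1 := hcoef i (by omega)
    rw [← ip_X_mul, ip_comm V (X * _),
      ip_monicOP_of_degree_lt hV h (q := X * monicOP V i)] at h1
    · exact (mul_eq_zero.1 h1).resolve_right (ip_monicOP_self_pos hV h i).ne'
    · rw [degree_mul, degree_X, monicOP_degree]
      have : 1 + i < k + 1 := by omega
      exact_mod_cast this
  refine ⟨γ (k + 1), γ k, ?_, ?_⟩
  · rw [Finset.sum_range_succ, Finset.sum_range_succ, Finset.sum_eq_zero, zero_add] at hγ
    · linear_combination hγ
    · intro i hi
      rw [hz i (Finset.mem_range.1 hi), C_0, zero_mul]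
  · have h1 := hcoef k (by omega)
    rw [← ip_X_mul, ip_comm V (X * _), ip_monicOP_X_mul hV h] at h1
    have h2 := (ip_monicOP_self_pos hV h k).ne'
    have h3 := (ip_monicOP_self_pos hV h (k + 1)).ne'
    rw [kappaSq, kappaSq]
    field_simp
    linarith

theorem kappaSq_mul_ip (hV : Continuous V)
    (h : ∀ k : ℕ, Integrable (fun x : ℝ => x ^ k * Real.exp (-V x))) (k : ℕ) :
    kappaSq V k * ip V (monicOP V k) (monicOP V k) = 1 :=
  inv_mul_cancel₀ (ip_monicOP_self_pos hV h k).ne'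

theorem monicOP_zero (V : ℝ → ℝ) : monicOP V 0 = 1 := by
  rw [monicOP_eq]; simp

/-- Induction on n with the three term recurrence: the middle coefficient cancels by antisymmetry in
x and y, and the relation between c and the norms makes the sum telescope. -/
theorem christoffelDarboux (hV : Continuous V)
    (h : ∀ k : ℕ, Integrable (fun x : ℝ => x ^ k * Real.exp (-V x))) (n : ℕ) (x y : ℝ) :
    (x - y) * ∑ k ∈ Finset.range (n + 1), kappaSq V k *
        ((monicOP V k).eval x * (monicOP V k).eval y)
      = kappaSq V n * ((monicOP V (n + 1)).eval x * (monicOP V n).eval y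
        - (monicOP V n).eval x * (monicOP V (n + 1)).eval y) := by
  induction n with
  | zero =>
    have h1 : (monicOP V 1 - X).degree < ((1 : ℕ) : WithBot ℕ) := by
      have := degree_X_mul_monicOP_sub V 0
      rw [monicOP_zero, mul_one] at this
      rw [← degree_neg, neg_sub]
      exact this
    obtain ⟨c, hc⟩ : ∃ c, monicOP V 1 = X + C c := by
      obtain ⟨γ, hγ⟩ := exists_eq_sum_monicOP V 1 h1
      refine ⟨γ 0, ?_⟩
      rw [Finset.sum_range_one, monicOP_zero, mul_one] at hγ
      rw [← hγ]; ring
    simp [monicOP_zero, hc]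
    ring
  | succ n ih =>
    obtain ⟨b, c, hbc, hc⟩ := X_mul_monicOP hV h n
    have hx := congrArg (eval x) hbc
    have hy := congrArg (eval y) hbc
    simp only [eval_mul, eval_add, eval_X, eval_C] at hx hy
    rw [Finset.sum_range_succ, mul_add, ih, ← hc]
    linear_combination (kappaSq V (n + 1) * (monicOP V (n + 1)).eval y) * hx
      - (kappaSq V (n + 1) * (monicOP V (n + 1)).eval x) * hy

/-- The Christoffel-Darboux kernel without its weight. -/
noncomputable def cdKernel (n : ℕ) (V : ℝ → ℝ) (x y : ℝ) : ℝ :=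
  ∑ k ∈ Finset.range n, kappaSq V k * ((monicOP V k).eval x * (monicOP V k).eval y)

theorem kernelZero_eq (hV : Continuous V)
    (h : ∀ k : ℕ, Integrable (fun x : ℝ => x ^ k * Real.exp (-V x))) {n : ℕ} (hn : 1 ≤ n)
    {x y : ℝ} (hxy : x ≠ y) : kernelZero n V x y = Real.exp (-V x) * cdKernel n V x y := by
  obtain ⟨n, rfl⟩ := Nat.exists_eq_add_of_le' hn
  have := christoffelDarboux hV h n x y
  rw [kernelZero, div_eq_iff (sub_ne_zero.2 hxy), cdKernel, add_tsub_cancel_right]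
  linear_combination (-Real.exp (-V x)) * this

end OrthogonalPolynomials

/-! ### Zeros of polynomials plus exponential sums, and sign patterns. -/

section ChebyshevSystem

/-- Rolle between consecutive zeros. The clause that each new zero lies below some point of T is
what makes the induction work: the next Rolle point lies above all of T, so it is distinct from the
earlier ones. -/
theorem exists_finset_zeros_deriv {f f' : ℝ → ℝ} (hf : ∀ x, HasDerivAt f (f' x) x) (T : Finset ℝ)
    (hT : ∀ x ∈ T, f x = 0) :
    ∃ T' : Finset ℝ, T.card ≤ T'.card + 1 ∧ ∀ y ∈ T', f' y = 0 ∧ ∃ x ∈ T, y < x := by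
  induction T using Finset.induction_on_max with
  | empty => exact ⟨∅, by simp, by simp⟩
  | insert z T hz ih =>
    obtain ⟨T', hcard, hT'⟩ := ih fun x hx => hT x (Finset.mem_insert_of_mem hx)
    rcases T.eq_empty_or_nonempty with rfl | hne
    · exact ⟨∅, by simp, by simp⟩
    · have hmax := T.max'_mem hne
      obtain ⟨y, hy, hy0⟩ := exists_hasDerivAt_eq_zero (hz _ hmax)
        (fun x _ => (hf x).continuousAt.continuousWithinAt)
        ((hT _ (Finset.mem_insert_of_mem hmax)).trans (hT z (Finset.mem_insert_self _ _)).symm)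
        (fun x _ => hf x)
      have hyT : y ∉ T' := fun hc => by
        obtain ⟨x, hx, hyx⟩ := (hT' y hc).2
        exact absurd (hyx.trans_le (T.le_max' x hx)) hy.1.not_gt
      have hzT : z ∉ T := fun hc => lt_irrefl _ (hz z hc)
      refine ⟨insert y T', ?_, ?_⟩
      · rw [Finset.card_insert_of_notMem hyT, Finset.card_insert_of_notMem hzT]
        omega
      · intro u hu
        rcases Finset.mem_insert.1 hu with rfl | hu
        · exact ⟨hy0, z, Finset.mem_insert_self _ _, hy.2⟩
        · obtain ⟨h1, x, hx, hux⟩ := hT' u hu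
          exact ⟨h1, x, Finset.mem_insert_of_mem hx, hux⟩

/-- An exponential sum with `N` terms has fewer than `N` zeros. -/
theorem card_zeros_expSum_lt {ι : Type*} {a : ι → ℝ} (ha : Function.Injective a) (S : Finset ι)
    (c : ι → ℝ) (hc : ∃ j ∈ S, c j ≠ 0) (T : Finset ℝ)
    (hT : ∀ x ∈ T, ∑ j ∈ S, c j * Real.exp (a j * x) = 0) : T.card < S.card := by
  classical
  induction S using Finset.induction_on generalizing c T with
  | empty => simp at hc
  | insert t S ht ih =>
    rw [Finset.card_insert_of_notMem ht]
    by_cases hS : ∃ j ∈ S, c j ≠ 0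
    -- After division by e^{a_t x} the t-th term is constant, so differentiation removes it at the
    -- cost of at most one zero.
    · have hder : ∀ x : ℝ, HasDerivAt
          (fun x => ∑ j ∈ insert t S, c j * Real.exp ((a j - a t) * x))
          (∑ j ∈ insert t S, c j * (Real.exp ((a j - a t) * x) * (a j - a t))) x := by
        intro x
        refine HasDerivAt.fun_sum fun j _ => ?_
        have h1 : HasDerivAt (fun x : ℝ => (a j - a t) * x) (a j - a t) x := by
          simpa using (hasDerivAt_id x).const_mul (a j - a t)
        exact h1.exp.const_mul _
      have hexp : ∀ j x, Real.exp ((a j - a t) * x)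
          = Real.exp (-(a t * x)) * Real.exp (a j * x) := by
        intro j x
        rw [← Real.exp_add]; congr 1; ring
      obtain ⟨T', hcard, hT'⟩ := exists_finset_zeros_deriv hder T (fun x hx => by
        simp only [hexp]
        rw [← mul_zero (Real.exp (-(a t * x))), ← hT x hx, Finset.mul_sum]
        exact Finset.sum_congr rfl fun j _ => by ring)
      have := ih (fun j => c j * (a j - a t)) (by
        obtain ⟨j, hj, hcj⟩ := hS
        refine ⟨j, hj, mul_ne_zero hcj (sub_ne_zero.2 fun h => ?_)⟩
        exact ht (ha h ▸ hj)) T' (fun x hx => by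
          have h1 := (hT' x hx).1
          rw [Finset.sum_insert ht] at h1
          simp only [hexp, sub_self, mul_zero, zero_add] at h1
          have h2 : Real.exp (-(a t * x)) * ∑ j ∈ S, c j * (a j - a t) * Real.exp (a j * x) = 0 := by
            rw [← h1, Finset.mul_sum]
            exact Finset.sum_congr rfl fun j _ => by ring
          exact (mul_eq_zero.1 h2).resolve_left (Real.exp_pos _).ne')
      omega
    · push Not at hS
      obtain ⟨j, hj, hcj⟩ := hc
      have hjt : j = t := (Finset.mem_insert.1 hj).resolve_right fun h => hcj (hS j h)
      subst hjt
      have : T = ∅ := by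
        rw [Finset.eq_empty_iff_forall_notMem]
        intro x hx
        have := hT x hx
        rw [Finset.sum_insert ht, Finset.sum_eq_zero fun i hi => by rw [hS i hi, zero_mul],
          add_zero] at this
        exact (mul_ne_zero hcj (Real.exp_pos _).ne') this
      simp [this]

/-- Differentiating m times kills the polynomial and loses at most m zeros. The coefficients c_j are
multiplied by a_j, which is why the exponents must be nonzero. -/
theorem card_zeros_poly_add_expSum_lt {ι : Type*} {a : ι → ℝ} (ha : Function.Injective a)
    (ha0 : ∀ j, a j ≠ 0) (S : Finset ι) (m : ℕ) (P : ℝ[X]) (hP : P.degree < m) (c : ι → ℝ)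
    (hc : ∃ j ∈ S, c j ≠ 0) (T : Finset ℝ)
    (hT : ∀ x ∈ T, P.eval x + ∑ j ∈ S, c j * Real.exp (a j * x) = 0) :
    T.card < m + S.card := by
  induction m generalizing P c T with
  | zero =>
    have hP0 : P = 0 := by simpa using hP
    rw [zero_add]
    refine card_zeros_expSum_lt ha S c hc T fun x hx => ?_
    simpa [hP0] using hT x hx
  | succ m ih =>
    have hder : ∀ x : ℝ, HasDerivAt (fun x => P.eval x + ∑ j ∈ S, c j * Real.exp (a j * x))
        (P.derivative.eval x + ∑ j ∈ S, (c j * a j) * Real.exp (a j * x)) x := by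
      intro x
      refine (P.hasDerivAt x).add (HasDerivAt.fun_sum fun j _ => ?_)
      have h1 : HasDerivAt (fun x : ℝ => a j * x) (a j) x := by
        simpa using (hasDerivAt_id x).const_mul (a j)
      exact (h1.exp.const_mul (c j)).congr_deriv (by ring)
    obtain ⟨T', hcard, hT'⟩ := exists_finset_zeros_deriv hder T hT
    have hdeg : P.derivative.degree < m := by
      rw [degree_lt_iff_coeff_zero]
      intro k hk
      rw [coeff_derivative, coeff_eq_zero_of_degree_lt, zero_mul]
      exact hP.trans_le (by exact_mod_cast Nat.succ_le_succ hk)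
    have := ih P.derivative hdeg (fun j => c j * a j)
      (by obtain ⟨j, hj, hcj⟩ := hc; exact ⟨j, hj, mul_ne_zero hcj (ha0 j)⟩) T'
      (fun x hx => (hT' x hx).1)
    omega

/-- A function whose sign changes only at the points of `Z` has the sign of a polynomial of degree
at most `Z.card`. -/
theorem exists_poly_mul_nonneg (Z : Finset ℝ) (f : ℝ → ℝ)
    (hf : ∀ x y, x ≤ y → (∀ z ∈ Z, z ∉ Set.Icc x y) → 0 < f x * f y) :
    ∃ p : ℝ[X], p ≠ 0 ∧ p.natDegree ≤ Z.card ∧ ∀ x ∉ Z, 0 ≤ p.eval x * f x := by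
  induction Z using Finset.induction_on_max generalizing f with
  | empty =>
    have hpos : ∀ x, 0 < f 0 * f x := fun x => by
      rcases le_total 0 x with h | h
      · exact hf 0 x h (by simp)
      · rw [mul_comm]; exact hf x 0 h (by simp)
    refine ⟨C (f 0), ?_, by simp, fun x _ => by simpa using (hpos x).le⟩
    rw [Ne, C_eq_zero]
    intro h0
    simpa [h0] using hpos 0
  | insert z Z hz ih =>
    have hzZ : z ∉ Z := fun hc => lt_irrefl _ (hz z hc)
    obtain ⟨u, huz, hu⟩ : ∃ u < z, ∀ s ∈ Z, s < u := by
      rcases Z.eq_empty_or_nonempty with rfl | hne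
      · exact ⟨z - 1, by linarith, by simp⟩
      · obtain ⟨u, hu1, hu2⟩ := exists_between (hz _ (Z.max'_mem hne))
        exact ⟨u, hu2, fun s hs => (Z.le_max' s hs).trans_lt hu1⟩
    have key : ∀ x y, x ≤ y → (∀ s ∈ Z, s ∉ Set.Icc x y) → y < z → 0 < f x * f y := by
      intro x y hxy h hy
      refine hf x y hxy fun s hs => ?_
      rcases Finset.mem_insert.1 hs with rfl | hs
      · exact fun hc => absurd hc.2 hy.not_ge
      · exact h s hs
    have fu : 0 < f u * f u := key u u le_rfl
      (fun s hs hc => absurd hc.1 (hu s hs).not_ge) huz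
    -- Freezing f from z onwards at its sign just to the left of z gives a function that changes
    -- sign only on the remaining points.
    set f' : ℝ → ℝ := fun x => if x < z then f x else f u with hf'
    obtain ⟨p, hp0, hpd, hp⟩ := ih f' (by
      intro x y hxy h
      by_cases hy : y < z
      · simp only [hf', hy, hxy.trans_lt hy, if_true]
        exact key x y hxy h hy
      · by_cases hx : x < z
        · simp only [hf', hx, hy, if_true, if_false]
          rcases le_total x u with hxu | hux
          · exact key x u hxu (fun s hs hc => h s hs ⟨hc.1, hc.2.trans (by linarith)⟩) huz
          · rw [mul_comm]
            exact key u x hux (fun s hs hc => absurd hc.1 (hu s hs).not_ge) hx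
        · simpa only [hf', hx, hy, if_false] using fu)
    rw [Finset.card_insert_of_notMem hzZ]
    have hgt : ∀ x, z < x → 0 < f (z + 1) * f x := by
      intro x hx
      have h1 : ∀ x y, z < x → x ≤ y → 0 < f x * f y := fun x y hx hxy =>
        hf x y hxy fun s hs hc => by
          rcases Finset.mem_insert.1 hs with rfl | hs
          · exact absurd hc.1 hx.not_ge
          · exact absurd hc.1 ((hz s hs).trans hx).not_ge
      rcases le_total (z + 1) x with h | h
      · exact h1 _ _ (by linarith) h
      · rw [mul_comm]; exact h1 _ _ hx h
    by_cases hsign : 0 < f u * f (z + 1)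
    · refine ⟨p, hp0, by omega, fun x hx => ?_⟩
      rw [Finset.mem_insert, not_or] at hx
      have h1 := hp x hx.2
      rcases lt_or_gt_of_ne hx.1 with h | h
      · simpa [hf', h] using h1
      · simp only [hf', h.not_gt, if_false] at h1
        have h2 := hgt x h
        have h4 : 0 ≤ (p.eval x * f x) * ((f u * f (z + 1)) ^ 2 * 1) := by
          have h3 : 0 ≤ (p.eval x * f u) * (f u * f (z + 1)) * (f (z + 1) * f x) := by positivity
          nlinarith [h3]
        exact nonneg_of_mul_nonneg_left h4 (by positivity)
    -- The sign does change at z. The factor z - X is positive to the left of z, where p is already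
    -- correct, and flips the sign to the right.
    · have hsign' : f u * f (z + 1) < 0 := by
        refine lt_of_le_of_ne (not_lt.1 hsign) (mul_ne_zero ?_ ?_)
        · rintro h0; simp [h0] at fu
        · intro h0
          have := hgt (z + 1) (by linarith)
          simp [h0] at this
      refine ⟨p * (C z - X), mul_ne_zero hp0 ?_, ?_, fun x hx => ?_⟩
      · rw [← neg_sub, neg_ne_zero]; exact X_sub_C_ne_zero z
      · refine natDegree_mul_le.trans (add_le_add hpd ?_)
        rw [← neg_sub, natDegree_neg, natDegree_X_sub_C]
      · rw [Finset.mem_insert, not_or] at hx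
        have h1 := hp x hx.2
        rw [eval_mul, eval_sub, eval_C, eval_X]
        rcases lt_or_gt_of_ne hx.1 with h | h
        · simp only [hf', h, if_true] at h1
          nlinarith
        · simp only [hf', h.not_gt, if_false] at h1
          have h2 := hgt x h
          have h5 : p.eval x * f x ≤ 0 := by
            by_contra! hc
            have h3 : 0 ≤ (p.eval x * f u) * -(f u * f (z + 1)) * (f (z + 1) * f x) := by
              have : 0 ≤ -(f u * f (z + 1)) := by linarith
              positivity
            have h4 : 0 < (p.eval x * f x) * (f u * f (z + 1)) ^ 2 := by
              have : f u * f (z + 1) ≠ 0 := hsign'.ne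
              positivity
            nlinarith
          nlinarith

end ChebyshevSystem

/-! ### Invertibility of B. -/

section InvertibleMatrix

/-- The pairing `∫ p(s) e^{b s} e^{-V(s)} ds`. -/
noncomputable def expPairing (V : ℝ → ℝ) (b : ℝ) (p : ℝ[X]) : ℝ :=
  ∫ s : ℝ, p.eval s * Real.exp (b * s) * Real.exp (-V s)

theorem integrable_expPairing {V : ℝ → ℝ} {b : ℝ}
    (hb : ∀ k : ℕ, Integrable (fun x : ℝ => x ^ k * Real.exp (-V x + b * x))) (p : ℝ[X]) :
    Integrable fun s : ℝ => p.eval s * Real.exp (b * s) * Real.exp (-V s) := by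
  have h := integrable_eval (V := fun x => V x - b * x)
    (fun k => by simpa [neg_sub, sub_eq_add_neg, add_comm] using hb k) p
  refine h.congr (.of_forall fun x => ?_)
  simp only [mul_assoc, ← Real.exp_add]
  ring_nf

theorem matB_apply {r : ℕ} (n : ℕ) (a : Fin r → ℝ) (V : ℝ → ℝ) (i j : Fin r) :
    matB n a V i j = expPairing V (a j) (monicOP V (n - r + i)) := rfl

/-- A kernel vector would produce a nonzero function orthogonal to all polynomials of degree less
than n but with fewer than n zeros. -/
theorem isUnit_matB {r : ℕ} {n : ℕ} (hr : r ≤ n) {a : Fin r → ℝ} (ha : Function.Injective a)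
    (ha0 : ∀ j, a j ≠ 0) {V : ℝ → ℝ} (hV : Continuous V) (hmom : FiniteMoments a V) :
    IsUnit (matB n a V) := by
  have h0 := fun k => (hmom k).1
  rw [← Matrix.mulVec_injective_iff_isUnit]
  suffices H : ∀ c, matB n a V *ᵥ c = 0 → c = 0 from fun c d h =>
    sub_eq_zero.1 (H _ (by rw [Matrix.mulVec_sub]; exact sub_eq_zero.2 h))
  intro c hc
  by_contra hc0
  obtain ⟨j₀, hj₀⟩ : ∃ j, c j ≠ 0 := by
    by_contra! h
    exact hc0 (funext h)
  set M : ℕ → ℝ := fun k => ∑ j, c j * expPairing V (a j) (monicOP V k) with hM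
  have hMz : ∀ k, n - r ≤ k → k < n → M k = 0 := by
    intro k hk hkn
    have := congrFun hc ⟨k - (n - r), by omega⟩
    simp only [Matrix.mulVec, dotProduct, matB_apply, Pi.zero_apply] at this
    rw [← this, hM]
    refine Finset.sum_congr rfl fun j _ => ?_
    rw [mul_comm, Nat.add_sub_cancel' hk]
  -- P is minus the orthogonal projection of the exponential sum onto polynomials of degree less
  -- than n - r.
  set P : ℝ[X] := ∑ k ∈ Finset.range (n - r), C (-(kappaSq V k * M k)) * monicOP V k with hP
  have hPd : P.degree < ((n - r : ℕ) : WithBot ℕ) := by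
    rw [← mem_degreeLT]
    refine Submodule.sum_mem _ fun k hk => ?_
    rw [mem_degreeLT, ← smul_eq_C_mul]
    refine (degree_smul_le _ _).trans_lt ?_
    rw [monicOP_degree]
    exact_mod_cast Finset.mem_range.1 hk
  set f : ℝ → ℝ := fun x => P.eval x + ∑ j, c j * Real.exp (a j * x) with hf
  have hfc : Continuous f := by fun_prop
  have hint : ∀ p : ℝ[X], Integrable fun x => p.eval x * f x * Real.exp (-V x) := by
    intro p
    have h1 := integrable_finsetSum (μ := volume) Finset.univ fun j _ =>
      (integrable_expPairing (fun k => (hmom k).2 j) p).const_mul (c j)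
    refine ((integrable_ip h0 p P).add h1).congr (.of_forall fun x => ?_)
    simp only [hf, Pi.add_apply, mul_add, add_mul, Finset.mul_sum, Finset.sum_mul]
    congr 1
    exact Finset.sum_congr rfl fun j _ => by ring
  have hintegral : ∀ p : ℝ[X], ∫ x, p.eval x * f x * Real.exp (-V x)
      = ip V p P + ∑ j, c j * expPairing V (a j) p := by
    intro p
    simp only [ip, expPairing, ← integral_const_mul]
    rw [← integral_finsetSum _ fun j _ =>
        (integrable_expPairing (fun k => (hmom k).2 j) p).const_mul (c j),
      ← integral_add (integrable_ip h0 p P) (integrable_finsetSum _ fun j _ =>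
        (integrable_expPairing (fun k => (hmom k).2 j) p).const_mul (c j))]
    congr 1 with x
    simp only [hf, mul_add, add_mul, Finset.mul_sum, Finset.sum_mul]
    congr 1
    exact Finset.sum_congr rfl fun j _ => by ring
  have horth : ∀ k < n, ∫ x, (monicOP V k).eval x * f x * Real.exp (-V x) = 0 := by
    intro k hk
    rw [hintegral]
    change _ + M k = 0
    rcases lt_or_ge k (n - r) with h | h
    · rw [hP, ip_monicOP_sum hV h0 h]
      linear_combination (-M k) * kappaSq_mul_ip hV h0 k
    · rw [hMz k h hk, add_zero, hP, ip_sum_right h0]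
      refine Finset.sum_eq_zero fun i hi => ?_
      rw [ip_C_mul_right, ip_monicOP_of_ne hV h0, mul_zero]
      have := Finset.mem_range.1 hi
      omega
  have hcard : ∀ T : Finset ℝ, (∀ x ∈ T, f x = 0) → T.card < n := by
    intro T hT
    have := card_zeros_poly_add_expSum_lt ha ha0 Finset.univ (n - r) P hPd c
      ⟨j₀, Finset.mem_univ _, hj₀⟩ T hT
    rw [Finset.card_univ, Fintype.card_fin] at this
    omega
  have hfin : {x | f x = 0}.Finite := by
    by_contra hinf
    obtain ⟨T, hT, hTn⟩ := Set.Infinite.exists_subset_card_eq hinf n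
    exact (hcard T fun x hx => hT hx).ne hTn
  -- By the intermediate value theorem f has constant strict sign on any interval without zeros.
  obtain ⟨p, hp0, hpd, hp⟩ := exists_poly_mul_nonneg hfin.toFinset f (by
    intro x y hxy h
    by_contra! hneg
    obtain ⟨z, hz, hz0⟩ : ∃ z ∈ Set.Icc x y, f z = 0 := by
      have := intermediate_value_uIcc (f := f) (a := x) (b := y) hfc.continuousOn
      rw [Set.uIcc_of_le hxy] at this
      have h0 : (0 : ℝ) ∈ Set.uIcc (f x) (f y) := by
        rw [Set.mem_uIcc]
        rcases le_total (f x) 0 with h1 | h1 <;> rcases le_total (f y) 0 with h2 | h2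
        · rcases h1.eq_or_lt with h3 | h3
          · exact Or.inr ⟨h2, h3.ge⟩
          · exact Or.inl ⟨h1, by nlinarith⟩
        · exact Or.inl ⟨h1, h2⟩
        · exact Or.inr ⟨h2, h1⟩
        · rcases h1.eq_or_lt with h3 | h3
          · exact Or.inl ⟨h3.ge, h2⟩
          · exact Or.inr ⟨by nlinarith, h1⟩
      obtain ⟨z, hz, hz0⟩ := this h0
      exact ⟨z, hz, hz0⟩
    exact h z (hfin.mem_toFinset.2 hz0) hz)
  have hnn : ∀ x, 0 ≤ p.eval x * f x * Real.exp (-V x) := by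
    intro x
    refine mul_nonneg ?_ (Real.exp_pos _).le
    by_cases hx : f x = 0
    · simp [hx]
    · exact hp x fun hc => hx (hfin.mem_toFinset.1 hc)
  have hpz : ∫ x, p.eval x * f x * Real.exp (-V x) = 0 := by
    have hlt : p.degree < n := by
      rw [degree_eq_natDegree hp0]
      exact_mod_cast hpd.trans_lt (hcard _ fun x hx => hfin.mem_toFinset.1 hx)
    obtain ⟨γ, hγ⟩ := exists_eq_sum_monicOP V n hlt
    have : ∀ x, p.eval x * f x * Real.exp (-V x) = ∑ k ∈ Finset.range n,
        γ k * ((monicOP V k).eval x * f x * Real.exp (-V x)) := by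
      intro x
      rw [hγ, eval_finsetSum, Finset.sum_mul, Finset.sum_mul]
      exact Finset.sum_congr rfl fun k _ => by rw [eval_mul, eval_C]; ring
    simp only [this]
    rw [integral_finsetSum _ fun k _ => (hint _).const_mul _]
    refine Finset.sum_eq_zero fun k hk => ?_
    rw [integral_const_mul, horth k (Finset.mem_range.1 hk), mul_zero]
  -- Away from the finitely many zeros of p and f the continuous nonnegative integrand is positive,
  -- so its integral cannot vanish.
  obtain ⟨x, hx⟩ : ∃ x, x ∉ (hfin.toFinset ∪ p.roots.toFinset) :=
    Infinite.exists_notMem_finset _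
  rw [Finset.mem_union, not_or, hfin.mem_toFinset, Multiset.mem_toFinset, mem_roots hp0] at hx
  refine (integral_pos_of_integrable_nonneg_nonzero (x := x) (by fun_prop) (hint p) hnn ?_).ne' hpz
  exact mul_ne_zero (mul_ne_zero hx.2 hx.1) (Real.exp_pos _).ne'

end InvertibleMatrix

/-! ### Contour integrals, Cauchy's formula and Liouville's theorem for functions with a jump on the
real line. -/

section Contour

/-- Cauchy's theorem on the rectangle with base [-R, R] and height R, for the continuous extension
of f to the closed half plane. On the other three sides, of total length 4R, f is o(1/R). -/
theorem tendsto_integral_boundary_upper {f : ℂ → ℂ} {fp : ℝ → ℂ}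
    (hd : DifferentiableOn ℂ f {z | 0 < z.im})
    (hu : ∀ x : ℝ, Tendsto f (𝓝[{z : ℂ | 0 < z.im}] (x : ℂ)) (𝓝 (fp x)))
    (h0 : Tendsto (fun z => z * f z) (Bornology.cobounded ℂ ⊓ 𝓟 {z : ℂ | 0 < z.im}) (𝓝 0)) :
    Tendsto (fun R : ℝ => ∫ x in (-R)..R, fp x) atTop (𝓝 0) := by
  set A : Set ℂ := {z | 0 < z.im} with hA
  have hAo : IsOpen A := isOpen_lt continuous_const Complex.continuous_im
  have hcl : closure A = {z : ℂ | 0 ≤ z.im} := Complex.closure_setOfPred_lt_im 0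
  set F := extendFrom A f with hF
  have hFA : ∀ z ∈ A, F z = f z := extendFrom_extends hd.continuousOn
  have hFr : ∀ x : ℝ, F x = fp x := fun x =>
    extendFrom_eq (by rw [hcl]; simp) (hu x)
  have hFc : ContinuousOn F {z : ℂ | 0 ≤ z.im} := by
    refine continuousOn_extendFrom hcl.ge fun z hz => ?_
    rcases (show 0 ≤ z.im from hz).eq_or_lt with h | h
    · have hz' : z = (z.re : ℂ) := by
        apply Complex.ext <;> simp [← h]
      rw [hz']
      exact ⟨_, hu _⟩
    · exact ⟨f z, hd.continuousOn z h⟩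
  have hFd : DifferentiableOn ℂ F A := hd.congr hFA
  rw [Metric.tendsto_atTop]
  intro ε hε
  -- The three sides contribute at most 2 + 1 + 1 = 4 times ε / 5, so the final bound is strict.
  have hev := h0 (Metric.ball_mem_nhds 0 (show 0 < ε / 5 by positivity))
  rw [Filter.mem_map, mem_inf_principal, ← Filter.eventually_iff,
    hasBasis_cobounded_norm.eventually_iff] at hev
  obtain ⟨ρ, -, hρ⟩ := hev
  refine ⟨max ρ 1, fun R hR => ?_⟩
  have hR1 : 1 ≤ R := (le_max_right _ _).trans hR
  have hR0 : 0 < R := by linarith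
  have hbd : ∀ z ∈ A, R ≤ ‖z‖ → ‖F z‖ ≤ ε / 5 / R := by
    intro z hz hzR
    have := hρ (show z ∈ {z | ρ ≤ ‖z‖} from ((le_max_left _ _).trans hR).trans hzR) hz
    rw [Set.mem_preimage, mem_ball_zero_iff, norm_mul] at this
    rw [hFA z hz, le_div_iff₀ hR0]
    nlinarith [norm_nonneg (f z)]
  have hrect := Complex.integral_boundary_rect_eq_zero_of_continuousOn_of_differentiableOn F
    (-R : ℂ) (R + R * Complex.I) (hFc.mono fun z hz => by
      have := hz.2
      simp [Set.uIcc_of_le hR0.le] at this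
      exact this.1) (hFd.mono fun z hz => by
      have := hz.2
      simp [hR0.le] at this
      exact this.1)
  simp only [Complex.neg_re, Complex.ofReal_re, Complex.add_re, Complex.mul_re, Complex.I_re,
    mul_zero, Complex.ofReal_im, Complex.I_im, mul_one, sub_self, add_zero, Complex.neg_im,
    neg_zero, Complex.ofReal_zero, zero_mul, Complex.add_im, Complex.mul_im, zero_add, hFr,
    smul_eq_mul] at hrect
  have hlen : |R - -R| = 2 * R := by rw [abs_of_pos (by linarith)]; ring
  have h1 : ‖∫ x in (-R)..R, F (x + R * Complex.I)‖ ≤ ε / 5 / R * |R - -R| := by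
    refine intervalIntegral.norm_integral_le_of_norm_le_const fun x _ => hbd _ (by simp [hA, hR0]) ?_
    refine le_trans ?_ (Complex.abs_im_le_norm _)
    simp [le_abs_self]
  have h2 : ‖∫ y in (0 : ℝ)..R, F (R + y * Complex.I)‖ ≤ ε / 5 / R * |R - 0| := by
    refine intervalIntegral.norm_integral_le_of_norm_le_const fun y hy => hbd _ ?_ ?_
    · rw [Set.uIoc_of_le hR0.le] at hy
      simpa [hA] using hy.1
    · refine le_trans ?_ (Complex.abs_re_le_norm _)
      simp [le_abs_self]
  have h3 : ‖∫ y in (0 : ℝ)..R, F ((-R : ℝ) + y * Complex.I)‖ ≤ ε / 5 / R * |R - 0| := by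
    refine intervalIntegral.norm_integral_le_of_norm_le_const fun y hy => hbd _ ?_ ?_
    · rw [Set.uIoc_of_le hR0.le] at hy
      simpa [hA] using hy.1
    · refine le_trans ?_ (Complex.abs_re_le_norm _)
      simp [le_abs_self]
  rw [sub_zero, abs_of_pos hR0] at h2 h3
  rw [hlen] at h1
  have hdiv : ε / 5 / R * R = ε / 5 := by field_simp
  rw [dist_zero_right]
  have heq : ∫ x in (-R)..R, fp x = (∫ x in (-R)..R, F (x + R * Complex.I))
      - Complex.I * (∫ y in (0 : ℝ)..R, F (R + y * Complex.I))
      + Complex.I * (∫ y in (0 : ℝ)..R, F ((-R : ℝ) + y * Complex.I)) := by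
    linear_combination hrect
  rw [heq]
  calc _ ≤ ‖∫ x in (-R)..R, F (x + R * Complex.I)‖
        + ‖∫ y in (0 : ℝ)..R, F (R + y * Complex.I)‖
        + ‖∫ y in (0 : ℝ)..R, F ((-R : ℝ) + y * Complex.I)‖ := by
        refine (norm_add_le _ _).trans (add_le_add ((norm_sub_le _ _).trans ?_) ?_)
        · rw [norm_mul, Complex.norm_I, one_mul]
        · rw [norm_mul, Complex.norm_I, one_mul]
    _ ≤ ε / 5 / R * (2 * R) + ε / 5 / R * R + ε / 5 / R * R := by gcongr
    _ = 4 * (ε / 5) := by rw [mul_left_comm, hdiv]; ring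
    _ < ε := by linarith

theorem tendsto_integral_boundary_lower {f : ℂ → ℂ} {fm : ℝ → ℂ}
    (hd : DifferentiableOn ℂ f {z | z.im < 0})
    (hl : ∀ x : ℝ, Tendsto f (𝓝[{z : ℂ | z.im < 0}] (x : ℂ)) (𝓝 (fm x)))
    (h0 : Tendsto (fun z => z * f z) (Bornology.cobounded ℂ ⊓ 𝓟 {z : ℂ | z.im < 0}) (𝓝 0)) :
    Tendsto (fun R : ℝ => ∫ x in (-R)..R, fm x) atTop (𝓝 0) := by
  -- The map z ↦ -z exchanges the half planes and preserves symmetric intervals.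
  have := tendsto_integral_boundary_upper (f := fun z => f (-z)) (fp := fun x => fm (-x))
    (hd.comp differentiable_neg.differentiableOn fun z hz => by simpa using hz)
    (fun x => (hl (-x)).comp (tendsto_nhdsWithin_iff.2 ⟨by
        have := (continuous_neg (G := ℂ)).tendsto (x : ℂ)
        rw [Complex.ofReal_neg]
        exact this.mono_left nhdsWithin_le_nhds,
      eventually_mem_nhdsWithin.mono fun z hz => by simpa using hz⟩))
    (by
      have h1 : Tendsto (fun z : ℂ => -z) (Bornology.cobounded ℂ ⊓ 𝓟 {z : ℂ | 0 < z.im})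
          (Bornology.cobounded ℂ ⊓ 𝓟 {z : ℂ | z.im < 0}) :=
        (tendsto_inf.2 ⟨tendsto_neg_cobounded.mono_left inf_le_left, tendsto_principal.2
          ((eventually_principal.2 fun z hz => by simpa using hz).filter_mono inf_le_right)⟩)
      have h2 := (h0.comp h1).neg
      rw [neg_zero] at h2
      refine h2.congr fun z => ?_
      simp)
  refine this.congr fun R => ?_
  rw [intervalIntegral.integral_comp_neg, neg_neg]

/-- The filter of neighbourhoods of infinity off the real line. -/
noncomputable abbrev offRealInfty : Filter ℂ := Bornology.cobounded ℂ ⊓ 𝓟 {z : ℂ | z.im ≠ 0}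

theorem tendsto_inv_offRealInfty : Tendsto (fun z : ℂ => z⁻¹) offRealInfty (𝓝 0) :=
  tendsto_inv₀_cobounded.mono_left inf_le_left

theorem eventually_ne_offRealInfty (c : ℂ) : ∀ᶠ z in offRealInfty, z ≠ c :=
  (Bornology.eventually_ne_cobounded c).filter_mono inf_le_left

/-- Only the difference of the boundary values is assumed integrable; each side separately is
controlled through integrals over [-R, R]. -/
theorem integral_jump_eq_zero {f : ℂ → ℂ} {fp fm : ℝ → ℂ}
    (hd : DifferentiableOn ℂ f {z : ℂ | z.im ≠ 0})
    (hu : ∀ x : ℝ, Tendsto f (𝓝[{z : ℂ | 0 < z.im}] (x : ℂ)) (𝓝 (fp x)))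
    (hl : ∀ x : ℝ, Tendsto f (𝓝[{z : ℂ | z.im < 0}] (x : ℂ)) (𝓝 (fm x)))
    (hfp : Continuous fp) (hfm : Continuous fm)
    (hint : Integrable fun x => fp x - fm x)
    (h0 : Tendsto (fun z => z * f z) offRealInfty (𝓝 0)) :
    ∫ x, (fp x - fm x) = 0 := by
  have h1 := tendsto_integral_boundary_upper (hd.mono fun z hz => ne_of_gt hz) hu
    (h0.mono_left (inf_le_inf_left _ (principal_mono.2 fun z hz => ne_of_gt hz)))
  have h2 := tendsto_integral_boundary_lower (hd.mono fun z hz => ne_of_lt hz) hl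
    (h0.mono_left (inf_le_inf_left _ (principal_mono.2 fun z hz => ne_of_lt hz)))
  have h3 := h1.sub h2
  rw [sub_zero] at h3
  refine tendsto_nhds_unique (intervalIntegral_tendsto_integral hint tendsto_neg_atTop_atBot
    tendsto_id) (h3.congr fun R => ?_)
  rw [id, intervalIntegral.integral_sub (hfp.intervalIntegrable _ _) (hfm.intervalIntegrable _ _)]

/-- The boundary values of a function are continuous. -/
theorem continuous_boundary {E : Type*} [TopologicalSpace E] [RegularSpace E] [T2Space E]
    {f : ℂ → E} {fp : ℝ → E} {A : Set ℂ} (hA : ∀ x : ℝ, (x : ℂ) ∈ closure A)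
    (hu : ∀ x : ℝ, Tendsto f (𝓝[A] (x : ℂ)) (𝓝 (fp x))) : Continuous fp := by
  have h : ContinuousOn (extendFrom A f) (Set.range ((↑) : ℝ → ℂ)) :=
    continuousOn_extendFrom (by rintro _ ⟨x, rfl⟩; exact hA x)
      (by rintro _ ⟨x, rfl⟩; exact ⟨_, hu x⟩)
  refine (h.comp_continuous Complex.continuous_ofReal fun x => ⟨x, rfl⟩).congr fun x => ?_
  exact extendFrom_eq (hA x) (hu x)

theorem ofReal_mem_closure_upper (x : ℝ) : (x : ℂ) ∈ closure {z : ℂ | 0 < z.im} := by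
  rw [Complex.closure_setOfPred_lt_im]; simp

theorem ofReal_mem_closure_lower (x : ℝ) : (x : ℂ) ∈ closure {z : ℂ | z.im < 0} := by
  rw [Complex.closure_setOfPred_im_lt]; simp

/-- A function that is holomorphic off the real line, with continuous boundary values and with
`z f(z) → c` at infinity, satisfies `∫ (f₊ - f₋) = -2πi c`. -/
theorem integral_jump {f : ℂ → ℂ} {fp fm : ℝ → ℂ} {c : ℂ}
    (hd : DifferentiableOn ℂ f {z : ℂ | z.im ≠ 0})
    (hu : ∀ x : ℝ, Tendsto f (𝓝[{z : ℂ | 0 < z.im}] (x : ℂ)) (𝓝 (fp x)))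
    (hl : ∀ x : ℝ, Tendsto f (𝓝[{z : ℂ | z.im < 0}] (x : ℂ)) (𝓝 (fm x)))
    (hint : Integrable fun x => fp x - fm x)
    (h0 : Tendsto (fun z => z * f z) offRealInfty (𝓝 c)) :
    ∫ x, (fp x - fm x) = -(2 * Real.pi * Complex.I) * c := by
  -- The comparison function h is 1/(z + i) above and 1/(z - i) below. It is holomorphic off the
  -- real line, z h(z) → 1, and its jump -2i/(1 + x²) has integral -2πi; subtracting c h reduces to
  -- the case c = 0.
  set σ : ℂ → ℂ := fun z => if 0 < z.im then Complex.I else -Complex.I with hσ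
  set h : ℂ → ℂ := fun z => (z + σ z)⁻¹ with hh
  have hup : ∀ z : ℂ, 0 ≤ z.im → z + Complex.I ≠ 0 := fun z hz h => by
    have := congrArg Complex.im h
    simp at this
    linarith
  have hlo : ∀ z : ℂ, z.im ≤ 0 → z - Complex.I ≠ 0 := fun z hz h => by
    have := congrArg Complex.im h
    simp at this
    linarith
  have hUo : IsOpen {z : ℂ | 0 < z.im} := isOpen_lt continuous_const Complex.continuous_im
  have hLo : IsOpen {z : ℂ | z.im < 0} := isOpen_lt Complex.continuous_im continuous_const
  have hhU : ∀ z ∈ {z : ℂ | 0 < z.im}, h z = (z + Complex.I)⁻¹ := fun z hz => by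
    simp only [hh, hσ, if_pos (show 0 < z.im from hz)]
  have hhL : ∀ z ∈ {z : ℂ | z.im < 0}, h z = (z - Complex.I)⁻¹ := fun z hz => by
    simp only [hh, hσ, if_neg (show z.im < 0 from hz).not_gt, sub_eq_add_neg]
  have hhd : DifferentiableOn ℂ h {z : ℂ | z.im ≠ 0} := by
    intro z hz
    refine DifferentiableAt.differentiableWithinAt ?_
    rcases lt_or_gt_of_ne (show z.im ≠ 0 from hz) with hz | hz
    · refine DifferentiableAt.congr_of_eventuallyEq ?_
        (Filter.eventuallyEq_of_mem (hLo.mem_nhds hz) hhL)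
      exact ((differentiableAt_id).sub_const _).inv (hlo z hz.le)
    · refine DifferentiableAt.congr_of_eventuallyEq ?_
        (Filter.eventuallyEq_of_mem (hUo.mem_nhds hz) hhU)
      exact ((differentiableAt_id).add_const _).inv (hup z hz.le)
  have hhu : ∀ x : ℝ, Tendsto h (𝓝[{z : ℂ | 0 < z.im}] (x : ℂ)) (𝓝 ((x + Complex.I)⁻¹)) := by
    intro x
    have : ContinuousAt (fun z : ℂ => (z + Complex.I)⁻¹) x :=
      (continuousAt_id.add continuousAt_const).inv₀ (hup x (by simp))
    exact (this.tendsto.mono_left nhdsWithin_le_nhds).congr'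
      (eventually_mem_nhdsWithin.mono fun z hz => (hhU z hz).symm)
  have hhl : ∀ x : ℝ, Tendsto h (𝓝[{z : ℂ | z.im < 0}] (x : ℂ)) (𝓝 ((x - Complex.I)⁻¹)) := by
    intro x
    have : ContinuousAt (fun z : ℂ => (z - Complex.I)⁻¹) x :=
      (continuousAt_id.sub continuousAt_const).inv₀ (hlo x (by simp))
    exact (this.tendsto.mono_left nhdsWithin_le_nhds).congr'
      (eventually_mem_nhdsWithin.mono fun z hz => (hhL z hz).symm)
  have hh0 : Tendsto (fun z => z * h z) offRealInfty (𝓝 1) := by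
    have hσb : Tendsto (fun z => σ z * z⁻¹) offRealInfty (𝓝 0) := by
      refine squeeze_zero_norm (a := fun z => ‖z⁻¹‖) (fun z => ?_) ?_
      · rw [norm_mul]
        simp only [hσ]
        split_ifs <;> simp
      · simpa using tendsto_inv_offRealInfty.norm
    have h1 : Tendsto (fun z => (1 + σ z * z⁻¹)⁻¹) offRealInfty (𝓝 (1 + 0)⁻¹) :=
      (hσb.const_add 1).inv₀ (by simp)
    rw [add_zero, inv_one] at h1
    refine h1.congr' ((eventually_ne_offRealInfty 0).mono fun z hz => ?_)
    simp only [hh]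
    rw [show z + σ z = z * (1 + σ z * z⁻¹) by field_simp, mul_inv]
    field_simp
  have hjump : ∀ x : ℝ, ((x : ℂ) + Complex.I)⁻¹ - ((x : ℂ) - Complex.I)⁻¹
      = ((-2 * Complex.I) * ((1 + x ^ 2)⁻¹ : ℝ) : ℂ) := by
    intro x
    have h1 := hup x (by simp)
    have h2 := hlo x (by simp)
    have h3 : ((x : ℂ) + Complex.I) * (x - Complex.I) = 1 + x ^ 2 := by
      linear_combination -Complex.I_sq
    push_cast
    rw [← h3]
    field_simp
    ring
  have hhint : Integrable fun x : ℝ => ((x : ℂ) + Complex.I)⁻¹ - ((x : ℂ) - Complex.I)⁻¹ := by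
    simp only [hjump]
    exact (integrable_inv_one_add_sq.ofReal).const_mul _
  have hhI : ∫ x : ℝ, (((x : ℂ) + Complex.I)⁻¹ - ((x : ℂ) - Complex.I)⁻¹)
      = -(2 * Real.pi * Complex.I) := by
    simp only [hjump]
    rw [integral_const_mul, integral_complex_ofReal, integral_univ_inv_one_add_sq]
    ring
  have e : ∀ x : ℝ, (fp x - fm x) - c * (((x : ℂ) + Complex.I)⁻¹ - ((x : ℂ) - Complex.I)⁻¹)
      = (fp x - c * ((x : ℂ) + Complex.I)⁻¹) - (fm x - c * ((x : ℂ) - Complex.I)⁻¹) :=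
    fun x => by ring
  have hu' := fun x => (hu x).sub ((hhu x).const_mul c)
  have hl' := fun x => (hl x).sub ((hhl x).const_mul c)
  have key := integral_jump_eq_zero (f := fun z => f z - c * h z) (hd.sub (hhd.const_mul c)) hu' hl'
    (continuous_boundary ofReal_mem_closure_upper hu')
    (continuous_boundary ofReal_mem_closure_lower hl')
    ((hint.sub (hhint.const_mul c)).congr (.of_forall e))
    (by
      have := h0.sub (hh0.const_mul c)
      rw [mul_one, sub_self] at this
      exact this.congr fun z => by ring)
  rw [← integral_congr_ae (.of_forall e), integral_sub hint (hhint.const_mul c),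
    integral_const_mul, hhI] at key
  linear_combination key

/-- Cauchy's formula: a function that is holomorphic off the real line and tends to `0` at infinity
is the Cauchy transform of its jump. -/
theorem integral_jump_div {f : ℂ → ℂ} {fp fm : ℝ → ℂ}
    (hd : DifferentiableOn ℂ f {z : ℂ | z.im ≠ 0})
    (hu : ∀ x : ℝ, Tendsto f (𝓝[{z : ℂ | 0 < z.im}] (x : ℂ)) (𝓝 (fp x)))
    (hl : ∀ x : ℝ, Tendsto f (𝓝[{z : ℂ | z.im < 0}] (x : ℂ)) (𝓝 (fm x)))
    {ζ : ℂ} (hζ : ζ.im ≠ 0)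
    (hint : Integrable fun x : ℝ => (fp x - fm x) / (x - ζ))
    (h0 : Tendsto f offRealInfty (𝓝 0)) :
    ∫ x : ℝ, (fp x - fm x) / (x - ζ) = (2 * Real.pi * Complex.I) * f ζ := by
  have hne : ∀ x : ℝ, (x : ℂ) - ζ ≠ 0 := fun x h => hζ (by
    rw [← sub_eq_zero.1 h]; simp)
  have hopen : IsOpen {z : ℂ | z.im ≠ 0} := isOpen_ne_fun Complex.continuous_im continuous_const
  have hslope : ∀ z ≠ ζ, dslope f ζ z = (f z - f ζ) / (z - ζ) := fun z hz => by
    rw [dslope_of_ne f hz, slope_def_field]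
  have hbd : ∀ (A : Set ℂ) (x : ℝ) (w : ℂ), Tendsto f (𝓝[A] (x : ℂ)) (𝓝 w) →
      Tendsto (dslope f ζ) (𝓝[A] (x : ℂ)) (𝓝 ((w - f ζ) / (x - ζ))) := by
    intro A x w hw
    have h1 : Tendsto (fun z : ℂ => z - ζ) (𝓝[A] (x : ℂ)) (𝓝 (x - ζ)) :=
      ((continuous_id.sub continuous_const).tendsto _).mono_left nhdsWithin_le_nhds
    refine ((hw.sub_const _).div h1 (hne x)).congr' ?_
    have h2 : ∀ᶠ z : ℂ in 𝓝 (x : ℂ), z ≠ ζ := eventually_ne_nhds (sub_ne_zero.1 (hne x))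
    exact (h2.filter_mono nhdsWithin_le_nhds).mono fun z hz => (hslope z hz).symm
  have e : ∀ x : ℝ, (fp x - fm x) / (x - ζ)
      = (fp x - f ζ) / (x - ζ) - (fm x - f ζ) / (x - ζ) := fun x => by
    rw [← sub_div]; ring
  -- The divided difference at ζ removes the pole: its jump is that of f divided by x - ζ, and z
  -- times it tends to -f(ζ).
  have := integral_jump (f := dslope f ζ) (c := -f ζ)
    ((Complex.differentiableOn_dslope (hopen.mem_nhds hζ)).2 hd)
    (fun x => hbd _ x _ (hu x)) (fun x => hbd _ x _ (hl x)) (hint.congr (.of_forall e)) (by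
      have h1 : Tendsto (fun z => (f z - f ζ) * (1 - ζ * z⁻¹)⁻¹) offRealInfty
          (𝓝 ((0 - f ζ) * (1 - ζ * 0)⁻¹)) :=
        (h0.sub_const _).mul (((tendsto_inv_offRealInfty.const_mul ζ).const_sub 1).inv₀ (by simp))
      rw [mul_zero, sub_zero, inv_one, mul_one, zero_sub] at h1
      refine h1.congr' ?_
      filter_upwards [eventually_ne_offRealInfty 0, eventually_ne_offRealInfty ζ] with z hz hzζ
      rw [hslope z hzζ]
      have : z - ζ ≠ 0 := sub_ne_zero.2 hzζ
      rw [show 1 - ζ * z⁻¹ = (z - ζ) * z⁻¹ by field_simp]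
      rw [mul_inv, inv_inv]
      field_simp)
  rw [integral_congr_ae (.of_forall e), this]
  ring

/-- Liouville's theorem for functions without a jump. -/
theorem exists_poly_of_no_jump {f : ℂ → ℂ} {f₀ : ℝ → ℂ} (m : ℕ)
    (hd : DifferentiableOn ℂ f {z : ℂ | z.im ≠ 0})
    (hu : ∀ x : ℝ, Tendsto f (𝓝[{z : ℂ | 0 < z.im}] (x : ℂ)) (𝓝 (f₀ x)))
    (hl : ∀ x : ℝ, Tendsto f (𝓝[{z : ℂ | z.im < 0}] (x : ℂ)) (𝓝 (f₀ x)))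
    (h0 : Tendsto (fun z => f z * (z⁻¹) ^ m) offRealInfty (𝓝 0)) :
    ∃ p : ℂ[X], p.degree < m ∧ ∀ z : ℂ, z.im ≠ 0 → f z = p.eval z := by
  induction m generalizing f f₀ with
  | zero =>
    refine ⟨0, by simp, fun z hz => ?_⟩
    have := integral_jump_div hd hu hl hz (by simp) (by simpa using h0)
    simp only [sub_self, zero_div, integral_zero, zero_eq_mul] at this
    rw [eval_zero]
    refine this.resolve_left ?_
    simp [Real.pi_ne_zero]
  | succ m ih =>
    have hI : Complex.I.im ≠ 0 := by simp
    have hne : ∀ x : ℝ, (x : ℂ) ≠ Complex.I := fun x h => by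
      have := congrArg Complex.im h
      simp at this
    have hopen : IsOpen {z : ℂ | z.im ≠ 0} :=
      isOpen_ne_fun Complex.continuous_im continuous_const
    have hslope : ∀ z ≠ Complex.I, dslope f Complex.I z
        = (f z - f Complex.I) / (z - Complex.I) := fun z hz => by
      rw [dslope_of_ne f hz, slope_def_field]
    have hbd : ∀ (A : Set ℂ) (x : ℝ) (w : ℂ), Tendsto f (𝓝[A] (x : ℂ)) (𝓝 w) →
        Tendsto (dslope f Complex.I) (𝓝[A] (x : ℂ))
          (𝓝 ((w - f Complex.I) / (x - Complex.I))) := by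
      intro A x w hw
      have h1 : Tendsto (fun z : ℂ => z - Complex.I) (𝓝[A] (x : ℂ)) (𝓝 (x - Complex.I)) :=
        ((continuous_id.sub continuous_const).tendsto _).mono_left nhdsWithin_le_nhds
      refine ((hw.sub_const _).div h1 (sub_ne_zero.2 (hne x))).congr' ?_
      have h2 : ∀ᶠ z : ℂ in 𝓝 (x : ℂ), z ≠ Complex.I := eventually_ne_nhds (hne x)
      exact (h2.filter_mono nhdsWithin_le_nhds).mono fun z hz => (hslope z hz).symm
    -- The divided difference at i, a point off the real line, still has no jump and grows one order
    -- slower.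
    obtain ⟨p, hp, hpf⟩ := ih (f := dslope f Complex.I)
      ((Complex.differentiableOn_dslope (hopen.mem_nhds hI)).2 hd)
      (fun x => hbd _ x _ (hu x)) (fun x => hbd _ x _ (hl x)) (by
        have h1 : Tendsto (fun z => (f z * (z⁻¹) ^ (m + 1) - f Complex.I * (z⁻¹) ^ (m + 1))
            * (1 - Complex.I * z⁻¹)⁻¹) offRealInfty
            (𝓝 ((0 - f Complex.I * 0 ^ (m + 1)) * (1 - Complex.I * 0)⁻¹)) :=
          (h0.sub ((tendsto_inv_offRealInfty.pow _).const_mul _)).mul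
            (((tendsto_inv_offRealInfty.const_mul _).const_sub 1).inv₀ (by simp))
        rw [zero_pow (Nat.succ_ne_zero m), mul_zero, sub_zero, zero_mul] at h1
        refine h1.congr' ?_
        filter_upwards [eventually_ne_offRealInfty 0, eventually_ne_offRealInfty Complex.I]
          with z hz hzI
        rw [hslope z hzI]
        have : z - Complex.I ≠ 0 := sub_ne_zero.2 hzI
        rw [show 1 - Complex.I * z⁻¹ = (z - Complex.I) * z⁻¹ by field_simp]
        rw [mul_inv, inv_inv, pow_succ]
        field_simp)
    refine ⟨(X - C Complex.I) * p + C (f Complex.I), ?_, fun z hz => ?_⟩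
    · refine (degree_add_le _ _).trans_lt (max_lt ?_ (degree_C_le.trans_lt (by
        exact_mod_cast m.succ_pos)))
      rw [degree_mul, degree_X_sub_C, Nat.cast_succ, add_comm]
      rcases eq_or_ne p 0 with rfl | h
      · simp
      · rw [degree_eq_natDegree h] at hp ⊢
        have : p.natDegree < m := by exact_mod_cast hp
        exact_mod_cast Nat.succ_lt_succ this
    · rw [eval_add, eval_mul, eval_sub, eval_X, eval_C, eval_C, ← hpf z hz]
      by_cases h : z = Complex.I
      · simp [h]
      · rw [hslope z h, mul_div_cancel₀ _ (sub_ne_zero.2 h)]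
        ring

end Contour

/-! ### The moment problem that characterises the kernel. -/

section Reproducing

theorem eval_map_ofReal (p : ℝ[X]) (x : ℝ) :
    (p.map (algebraMap ℝ ℂ)).eval (x : ℂ) = ((p.eval x : ℝ) : ℂ) := by
  rw [eval_map]
  exact eval₂_at_apply (algebraMap ℝ ℂ) x

theorem integrable_eval_ofReal {W : ℝ → ℝ} (h : ∀ k : ℕ, Integrable fun x : ℝ => x ^ k * W x)
    (Q : ℂ[X]) : Integrable fun x : ℝ => Q.eval (x : ℂ) * (W x : ℂ) := by
  simp only [eval_eq_sum_range, Finset.sum_mul, mul_assoc]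
  refine integrable_finsetSum _ fun i _ => Integrable.const_mul ?_ _
  refine (h i).ofReal.congr (.of_forall fun x => ?_)
  push_cast
  rfl

theorem sum_range_eq_sum_fin {M : Type*} [AddCommMonoid M] {r n : ℕ} (hr : r ≤ n) (g : ℕ → M)
    (hg : ∀ k < n - r, g k = 0) :
    ∑ k ∈ Finset.range n, g k = ∑ i : Fin r, g (n - r + i) := by
  conv_lhs => rw [← Nat.sub_add_cancel hr, Finset.sum_range_add]
  rw [Finset.sum_eq_zero fun k hk => hg k (Finset.mem_range.1 hk), zero_add, Finset.sum_range]

/-- The vector `w` with its argument extended to the complex plane. -/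
noncomputable def complexWVec {r : ℕ} (n : ℕ) (a : Fin r → ℝ) (V : ℝ → ℝ) (ζ : ℂ) (j : Fin r) : ℂ :=
  Complex.exp (a j * ζ) - ∑ k ∈ Finset.range n, (kappaSq V k : ℂ) *
    ((monicOP V k).map (algebraMap ℝ ℂ)).eval ζ * (expPairing V (a j) (monicOP V k) : ℂ)

/-- The kernel `K(x, ζ) e^{V(x)}`, with its second argument extended to the complex plane. -/
noncomputable def complexKernel {r : ℕ} (n : ℕ) (a : Fin r → ℝ) (V : ℝ → ℝ) (x : ℝ) (ζ : ℂ) : ℂ :=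
  ∑ k ∈ Finset.range n, (kappaSq V k : ℂ) * ((monicOP V k).map (algebraMap ℝ ℂ)).eval ζ *
      (((monicOP V k).eval x : ℝ) : ℂ)
    + ∑ j, complexWVec n a V ζ j * (((matB n a V)⁻¹ *ᵥ tVec n r V x) j : ℂ)

theorem continuous_complexKernel {r : ℕ} (n : ℕ) (a : Fin r → ℝ) (V : ℝ → ℝ) (x : ℝ) :
    Continuous (complexKernel n a V x) := by
  have h : ∀ k, Continuous fun ζ : ℂ => ((monicOP V k).map (algebraMap ℝ ℂ)).eval ζ :=
    fun k => Polynomial.continuous _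
  unfold complexKernel complexWVec
  fun_prop

variable {r n : ℕ} {a : Fin r → ℝ} {V : ℝ → ℝ}

/-- The polynomial whose moments reproduce the point evaluations at `ζ` is the kernel. -/
theorem eval_eq_complexKernel (hr : r ≤ n) (hV : Continuous V) (hmom : FiniteMoments a V)
    (hB : IsUnit (matB n a V)) {Q : ℂ[X]} (hQ : Q.degree < n) {ζ : ℂ}
    (h0 : ∀ m < n - r, ∫ x : ℝ, (x : ℂ) ^ m * Q.eval (x : ℂ) * (Real.exp (-V x) : ℂ) = ζ ^ m)
    (h1 : ∀ j, ∫ x : ℝ, Q.eval (x : ℂ) * (Real.exp (-V x + a j * x) : ℂ) = Complex.exp (a j * ζ))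
    (x : ℝ) : Q.eval (x : ℂ) = complexKernel n a V x ζ := by
  have hm := fun k => (hmom k).1
  obtain ⟨γ, hγ⟩ := exists_eq_sum_C_mul (b := fun k => (monicOP V k).map (algebraMap ℝ ℂ))
    (fun k => (monicOP_monic V k).map _)
    (fun k => by rw [(monicOP_monic V k).natDegree_map, monicOP_natDegree]) n hQ
  have hev : ∀ x : ℝ, Q.eval (x : ℂ) = ∑ k ∈ Finset.range n, γ k * (((monicOP V k).eval x : ℝ) : ℂ) := by
    intro x
    simp only [hγ, eval_finsetSum, eval_mul, eval_C, eval_map_ofReal]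
  have hip : ∀ k < n, ∫ x : ℝ, Q.eval (x : ℂ) * (((monicOP V k).eval x : ℝ) : ℂ) * (Real.exp (-V x) : ℂ)
      = γ k * (ip V (monicOP V k) (monicOP V k) : ℂ) := by
    intro k hk
    have e : ∀ x : ℝ, Q.eval (x : ℂ) * (((monicOP V k).eval x : ℝ) : ℂ) * (Real.exp (-V x) : ℂ)
        = ∑ l ∈ Finset.range n, γ l *
          (((monicOP V k).eval x * (monicOP V l).eval x * Real.exp (-V x) : ℝ) : ℂ) := by
      intro x
      rw [hev, Finset.sum_mul, Finset.sum_mul]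
      exact Finset.sum_congr rfl fun l _ => by push_cast; ring
    simp only [e]
    rw [integral_finsetSum _ fun l _ => (integrable_ip hm _ _).ofReal.const_mul _,
      Finset.sum_eq_single k]
    · rw [integral_const_mul, integral_complex_ofReal]; rfl
    · intro l _ hl
      rw [integral_const_mul, integral_complex_ofReal]
      have := ip_monicOP_of_ne hV hm hl
      unfold ip at this
      rw [this]; simp
    · exact fun hc => absurd (Finset.mem_range.2 hk) hc
  -- For k < n - r, all the monomials of π_k have prescribed moments, so the pairing of Q with π_k
  -- is π_k(ζ).
  have hγ0 : ∀ k < n - r,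
      γ k = (kappaSq V k : ℂ) * ((monicOP V k).map (algebraMap ℝ ℂ)).eval ζ := by
    intro k hk
    have e : ∀ x : ℝ, Q.eval (x : ℂ) * (((monicOP V k).eval x : ℝ) : ℂ) * (Real.exp (-V x) : ℂ)
        = ∑ m ∈ Finset.range (k + 1), ((monicOP V k).coeff m : ℂ) *
          ((x : ℂ) ^ m * Q.eval (x : ℂ) * (Real.exp (-V x) : ℂ)) := by
      intro x
      rw [eval_eq_sum_range (p := monicOP V k), monicOP_natDegree]
      push_cast
      rw [Finset.mul_sum, Finset.sum_mul]
      exact Finset.sum_congr rfl fun l _ => by ring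
    have hint : ∀ m, Integrable fun x : ℝ =>
        (x : ℂ) ^ m * Q.eval (x : ℂ) * (Real.exp (-V x) : ℂ) := fun m => by
      have := integrable_eval_ofReal hm ((X : ℂ[X]) ^ m * Q)
      refine this.congr (.of_forall fun x => ?_)
      simp only [eval_mul, eval_pow, eval_X]
    have h2 := hip k (by omega)
    simp only [e] at h2
    rw [integral_finsetSum _ fun l _ => (hint _).const_mul _] at h2
    have h3 : ∑ m ∈ Finset.range (k + 1), ∫ x : ℝ, ((monicOP V k).coeff m : ℂ) *
          ((x : ℂ) ^ m * Q.eval (x : ℂ) * (Real.exp (-V x) : ℂ))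
        = ((monicOP V k).map (algebraMap ℝ ℂ)).eval ζ := by
      rw [eval_map, eval₂_eq_sum_range, monicOP_natDegree]
      refine Finset.sum_congr rfl fun m hm' => ?_
      rw [integral_const_mul, h0 m (by have := Finset.mem_range.1 hm'; omega)]
      rfl
    rw [h3] at h2
    have h4 : (kappaSq V k : ℂ) * (ip V (monicOP V k) (monicOP V k) : ℂ) = 1 := by
      exact_mod_cast kappaSq_mul_ip hV hm k
    rw [h2]
    linear_combination (-γ k) * h4
  -- The deviation of the coefficients of Q from those of the Christoffel-Darboux kernel. It is
  -- supported on the top r indices, where the exponential moments turn it into a linear system with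
  -- matrix B and right side w(ζ).
  set η : ℕ → ℂ := fun k =>
    γ k - (kappaSq V k : ℂ) * ((monicOP V k).map (algebraMap ℝ ℂ)).eval ζ with hη
  have hη0 : ∀ k < n - r, η k = 0 := fun k hk => sub_eq_zero.2 (hγ0 k hk)
  have hηB : ∀ j, ∑ i : Fin r, η (n - r + i) * (matB n a V i j : ℂ) = complexWVec n a V ζ j := by
    intro j
    have e : ∀ x : ℝ, Q.eval (x : ℂ) * (Real.exp (-V x + a j * x) : ℂ)
        = ∑ k ∈ Finset.range n, γ k *
          (((monicOP V k).eval x * Real.exp (a j * x) * Real.exp (-V x) : ℝ) : ℂ) := by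
      intro x
      rw [hev, Finset.sum_mul, Real.exp_add]
      exact Finset.sum_congr rfl fun l _ => by push_cast; ring
    have h2 := h1 j
    simp only [e] at h2
    rw [integral_finsetSum _ fun l _ =>
      (integrable_expPairing (fun k => (hmom k).2 j) _).ofReal.const_mul _] at h2
    simp only [integral_const_mul, integral_complex_ofReal] at h2
    rw [complexWVec, ← h2, ← Finset.sum_sub_distrib]
    simp only [matB_apply]
    rw [← sum_range_eq_sum_fin hr (fun k => η k * (expPairing V (a j) (monicOP V k) : ℂ))
      fun k hk => by rw [hη0 k hk, zero_mul]]
    refine Finset.sum_congr rfl fun k _ => ?_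
    rw [hη, sub_mul]; rfl
  have hinv : ∀ i l, ∑ j, (matB n a V i j : ℂ) * ((matB n a V)⁻¹ j l : ℂ)
      = if i = l then 1 else 0 := by
    intro i l
    have h2 := congrFun (congrFun (Matrix.mul_nonsing_inv (matB n a V)
      ((Matrix.isUnit_iff_isUnit_det _).1 hB)) i) l
    rw [Matrix.mul_apply, Matrix.one_apply] at h2
    have h3 := congrArg (fun t : ℝ => (t : ℂ)) h2
    push_cast at h3
    rw [h3]
    split_ifs <;> simp
  have hηW : ∀ l : Fin r, η (n - r + l)
      = ∑ j, complexWVec n a V ζ j * ((matB n a V)⁻¹ j l : ℂ) := by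
    intro l
    calc η (n - r + l) = ∑ i : Fin r, η (n - r + i) * (if i = l then 1 else 0) := by simp
      _ = ∑ i : Fin r, ∑ j, η (n - r + i) * ((matB n a V i j : ℂ) * ((matB n a V)⁻¹ j l : ℂ)) := by
        simp only [← hinv, Finset.mul_sum]
      _ = _ := by
        rw [Finset.sum_comm]
        refine Finset.sum_congr rfl fun j _ => ?_
        rw [← hηB, Finset.sum_mul]
        exact Finset.sum_congr rfl fun i _ => by ring
  have hsplit : Q.eval (x : ℂ) = ∑ k ∈ Finset.range n, (kappaSq V k : ℂ) *
      ((monicOP V k).map (algebraMap ℝ ℂ)).eval ζ * (((monicOP V k).eval x : ℝ) : ℂ)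
      + ∑ k ∈ Finset.range n, η k * (((monicOP V k).eval x : ℝ) : ℂ) := by
    rw [hev, ← Finset.sum_add_distrib]
    exact Finset.sum_congr rfl fun k _ => by rw [hη]; ring
  rw [hsplit, complexKernel, sum_range_eq_sum_fin hr (fun k => η k * (((monicOP V k).eval x : ℝ) : ℂ))
    fun k hk => by rw [hη0 k hk, zero_mul]]
  congr 1
  simp only [hηW, Finset.sum_mul, Matrix.mulVec, dotProduct]
  rw [Finset.sum_comm]
  refine Finset.sum_congr rfl fun j _ => ?_
  push_cast
  rw [Finset.mul_sum]
  exact Finset.sum_congr rfl fun l _ => by rw [tVec]; ring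

/-- The quotient formula for K₀(s, y) agrees with the Christoffel-Darboux sum except at s = y, a
null set. -/
theorem wVec_eq (hn : 1 ≤ n) (hV : Continuous V) (hmom : FiniteMoments a V) (y : ℝ) (j : Fin r) :
    wVec n a V y j = Real.exp (a j * y) - ∑ k ∈ Finset.range n, kappaSq V k *
      (monicOP V k).eval y * expPairing V (a j) (monicOP V k) := by
  have hm := fun k => (hmom k).1
  rw [wVec, vVec]
  congr 1
  have hae : ∀ᵐ s : ℝ, kernelZero n V s y * vVec a s j = ∑ k ∈ Finset.range n,
      (kappaSq V k * (monicOP V k).eval y) *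
        ((monicOP V k).eval s * Real.exp (a j * s) * Real.exp (-V s)) := by
    filter_upwards [compl_mem_ae_iff.2 (measure_singleton y)] with s hs
    rw [kernelZero_eq hV hm hn hs, cdKernel, vVec, Finset.mul_sum, Finset.sum_mul]
    exact Finset.sum_congr rfl fun k _ => by ring
  rw [integral_congr_ae hae, integral_finsetSum _ fun k _ =>
    (integrable_expPairing (fun k => (hmom k).2 j) _).const_mul _]
  simp only [integral_const_mul]
  rfl

theorem complexKernel_ofReal (hn : 1 ≤ n) (hV : Continuous V) (hmom : FiniteMoments a V)
    (x y : ℝ) : complexKernel n a V x y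
      = ((cdKernel n V x y + wVec n a V y ⬝ᵥ ((matB n a V)⁻¹ *ᵥ tVec n r V x) : ℝ) : ℂ) := by
  rw [complexKernel, cdKernel, dotProduct]
  push_cast
  congr 1
  · refine Finset.sum_congr rfl fun k _ => ?_
    rw [eval_map_ofReal]; ring
  · refine Finset.sum_congr rfl fun j _ => ?_
    rw [wVec_eq hn hV hmom, complexWVec]
    push_cast
    simp only [eval_map_ofReal]

end Reproducing

/-! ### Consequences of the Riemann-Hilbert problem and the kernel formula. -/

section RiemannHilbert

/-- The weights `e^{-V}, e^{-V + a_1 x}, …, e^{-V + a_r x}`. -/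
noncomputable def weight {r : ℕ} (a : Fin r → ℝ) (V : ℝ → ℝ) (k : Fin (r + 1)) (x : ℝ) : ℝ :=
  vecCons (α := ℝ) (Real.exp (-V x)) (fun j => Real.exp (-V x + a j * x)) k

/-- The vector `(0, 1, e^{a_1 ζ}, …, e^{a_r ζ})`. -/
noncomputable def dualVec {r : ℕ} (a : Fin r → ℝ) (ζ : ℂ) : Fin (r + 2) → ℂ :=
  vecCons 0 (vecCons 1 fun j => Complex.exp (a j * ζ))

variable {r n : ℕ} {a : Fin r → ℝ} {V : ℝ → ℝ}

theorem integrable_pow_mul_weight (hmom : FiniteMoments a V) (k : Fin (r + 1)) (m : ℕ) :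
    Integrable fun x : ℝ => x ^ m * weight a V k x := by
  refine Fin.cases ?_ (fun j => ?_) k
  · exact (hmom m).1
  · exact (hmom m).2 j

theorem jumpMatrix_zero_zero (x : ℝ) : jumpMatrix a V x 0 0 = 1 := by
  simp [jumpMatrix]

theorem jumpMatrix_zero_succ (x : ℝ) (k : Fin (r + 1)) :
    jumpMatrix a V x 0 k.succ = weight a V k x := by
  rw [jumpMatrix, Matrix.updateRow_self, Matrix.cons_val_succ]
  refine Fin.cases ?_ (fun j => ?_) k <;> rfl

theorem jumpMatrix_succ (x : ℝ) (l : Fin (r + 1)) (m : Fin (r + 2)) :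
    jumpMatrix a V x l.succ m = (1 : Matrix (Fin (r + 2)) (Fin (r + 2)) ℂ) l.succ m := by
  rw [jumpMatrix, Matrix.updateRow_ne (Fin.succ_ne_zero l)]

theorem mul_jumpMatrix_zero (M : Matrix (Fin (r + 2)) (Fin (r + 2)) ℂ) (x : ℝ)
    (i : Fin (r + 2)) : (M * jumpMatrix a V x) i 0 = M i 0 := by
  rw [Matrix.mul_apply, Fin.sum_univ_succ, jumpMatrix_zero_zero]
  simp [jumpMatrix_succ]

theorem mul_jumpMatrix_succ (M : Matrix (Fin (r + 2)) (Fin (r + 2)) ℂ) (x : ℝ)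
    (i : Fin (r + 2)) (k : Fin (r + 1)) :
    (M * jumpMatrix a V x) i k.succ = M i k.succ + M i 0 * weight a V k x := by
  rw [Matrix.mul_apply, Fin.sum_univ_succ, jumpMatrix_zero_succ, add_comm]
  simp [jumpMatrix_succ, Matrix.one_apply]

theorem det_jumpMatrix (x : ℝ) : (jumpMatrix a V x).det = 1 := by
  rw [Matrix.det_of_isUpperTriangular]
  · rw [Fin.prod_univ_succ, jumpMatrix_zero_zero]
    simp [jumpMatrix_succ]
  · intro i j hij
    obtain ⟨l, rfl⟩ := Fin.exists_succ_eq.2 (Fin.pos_iff_ne_zero.1 ((Fin.zero_le j).trans_lt hij))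
    rw [jumpMatrix_succ]
    exact Matrix.one_apply_ne hij.ne'

/-- This makes the diagonal factor at infinity unimodular, so that det Z tends to 1. -/
theorem sum_rhpExponent (n r : ℕ) : ∑ k, rhpExponent n r k = 0 := by
  rw [Fin.sum_univ_succ, Fin.sum_univ_succ]
  simp [rhpExponent]

theorem prod_zpow {ι : Type*} {z : ℂ} (hz : z ≠ 0) (s : Finset ι) (e : ι → ℤ) :
    ∏ k ∈ s, z ^ e k = z ^ ∑ k ∈ s, e k := by
  classical
  induction s using Finset.induction_on with
  | empty => simp
  | insert k s hk ih => rw [Finset.prod_insert hk, Finset.sum_insert hk, ih, zpow_add₀ hz]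

variable {Z : ℂ → Matrix (Fin (r + 2)) (Fin (r + 2)) ℂ}
  {Zp Zm : ℝ → Matrix (Fin (r + 2)) (Fin (r + 2)) ℂ}

namespace IsRHPSolution

theorem upper_apply (hZ : IsRHPSolution n a V Z Zp Zm) (x : ℝ) (i j) :
    Tendsto (fun z => Z z i j) (𝓝[{z : ℂ | 0 < z.im}] (x : ℂ)) (𝓝 (Zp x i j)) :=
  ((continuous_id.matrix_elem i j).tendsto _).comp (hZ.upper x)

theorem lower_apply (hZ : IsRHPSolution n a V Z Zp Zm) (x : ℝ) (i j) :
    Tendsto (fun z => Z z i j) (𝓝[{z : ℂ | z.im < 0}] (x : ℂ)) (𝓝 (Zm x i j)) :=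
  ((continuous_id.matrix_elem i j).tendsto _).comp (hZ.lower x)

theorem jump_zero (hZ : IsRHPSolution n a V Z Zp Zm) (x : ℝ) (i) : Zp x i 0 = Zm x i 0 := by
  rw [hZ.jump, mul_jumpMatrix_zero]

theorem jump_succ (hZ : IsRHPSolution n a V Z Zp Zm) (x : ℝ) (i) (k : Fin (r + 1)) :
    Zp x i k.succ - Zm x i k.succ = Zp x i 0 * weight a V k x := by
  rw [hZ.jump, mul_jumpMatrix_zero, mul_jumpMatrix_succ]; ring

theorem tendsto_mul_zpow (hZ : IsRHPSolution n a V Z Zp Zm) (i j) :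
    Tendsto (fun z => Z z i j * z ^ (-rhpExponent n r j)) offRealInfty
      (𝓝 ((1 : Matrix (Fin (r + 2)) (Fin (r + 2)) ℂ) i j)) := by
  have h := (hZ.asymptotics i j).trans_tendsto tendsto_inv_offRealInfty
  have h2 := h.add_const ((1 : Matrix (Fin (r + 2)) (Fin (r + 2)) ℂ) i j)
  rw [zero_add] at h2
  refine h2.congr fun z => ?_
  rw [sub_add_cancel, Matrix.mul_diagonal]

/-- The first column of the jump matrix is that of the identity, so the first column of Z has no
jump, and it is O(z^n): Liouville applies. -/
theorem exists_poly (hZ : IsRHPSolution n a V Z Zp Zm) (i) :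
    ∃ p : ℂ[X], p.degree < ((n + 1 : ℕ) : WithBot ℕ) ∧ (∀ z : ℂ, z.im ≠ 0 → Z z i 0 = p.eval z) ∧
      (∀ x : ℝ, Zp x i 0 = p.eval (x : ℂ)) ∧ ∀ x : ℝ, Zm x i 0 = p.eval (x : ℂ) := by
  obtain ⟨p, hp, hpz⟩ := exists_poly_of_no_jump (n + 1) (hZ.analytic i 0)
    (fun x => hZ.upper_apply x i 0)
    (fun x => by rw [hZ.jump_zero]; exact hZ.lower_apply x i 0) (by
      have h := (hZ.tendsto_mul_zpow i 0).mul tendsto_inv_offRealInfty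
      rw [mul_zero] at h
      refine h.congr fun z => ?_
      have : -rhpExponent n r 0 = -(n : ℤ) := rfl
      rw [this, _root_.zpow_neg, zpow_natCast, pow_succ, inv_pow, mul_assoc])
  have hpx : ∀ x : ℝ, Zp x i 0 = p.eval (x : ℂ) := by
    intro x
    have := mem_closure_iff_nhdsWithin_neBot.1 (ofReal_mem_closure_upper x)
    refine tendsto_nhds_unique (hZ.upper_apply x i 0) ?_
    refine Tendsto.congr' (eventually_mem_nhdsWithin.mono fun z hz => (hpz z (ne_of_gt hz)).symm) ?_
    exact (p.continuous.tendsto _).mono_left nhdsWithin_le_nhds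
  exact ⟨p, hp, hpz, hpx, fun x => (hZ.jump_zero x i).symm.trans (hpx x)⟩

/-- The jump matrix has determinant 1, so det Z has no jump; being bounded at infinity it is
constant, and its limit there is 1. -/
theorem det_eq_one (hZ : IsRHPSolution n a V Z Zp Zm) {z : ℂ} (hz : z.im ≠ 0) :
    (Z z).det = 1 := by
  have hdet : Continuous fun M : Matrix (Fin (r + 2)) (Fin (r + 2)) ℂ => M.det :=
    continuous_id.matrix_det
  have hlim : Tendsto (fun z => (Z z).det) offRealInfty (𝓝 1) := by
    have h1 : Tendsto (fun z => Z z * Matrix.diagonal fun k => z ^ (-rhpExponent n r k))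
        offRealInfty (𝓝 1) := by
      refine tendsto_pi_nhds.2 fun i => tendsto_pi_nhds.2 fun j => ?_
      simpa only [Matrix.mul_diagonal] using hZ.tendsto_mul_zpow i j
    have h2 := (hdet.tendsto 1).comp h1
    rw [Matrix.det_one] at h2
    refine h2.congr' ((eventually_ne_offRealInfty 0).mono fun z hz => ?_)
    rw [Function.comp_apply, Matrix.det_mul, Matrix.det_diagonal, prod_zpow hz,
      Finset.sum_neg_distrib, sum_rhpExponent, neg_zero, zpow_zero, mul_one]
  obtain ⟨p, hp, hpz⟩ := exists_poly_of_no_jump (f := fun z => (Z z).det) 1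
    (by
      simp only [Matrix.det_apply]
      refine DifferentiableOn.fun_sum fun σ _ => DifferentiableOn.const_smul ?_ _
      exact DifferentiableOn.fun_finsetProd fun i _ => hZ.analytic _ _)
    (fun x => (hdet.tendsto _).comp (hZ.upper x))
    (fun x => by
      rw [hZ.jump, Matrix.det_mul, det_jumpMatrix, mul_one]
      exact (hdet.tendsto _).comp (hZ.lower x))
    (by simpa using hlim.mul tendsto_inv_offRealInfty)
  have hpc : p = C (p.coeff 0) := eq_C_of_degree_le_zero (Order.lt_succ_iff.1 hp)
  -- Uniqueness of limits needs points off the real line of arbitrarily large modulus, here on the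
  -- imaginary axis.
  have : NeBot offRealInfty := by
    rw [inf_principal_neBot_iff]
    intro U hU
    obtain ⟨R, -, hR⟩ := hasBasis_cobounded_norm.mem_iff.1 hU
    refine ⟨((|R| + 1 : ℝ) : ℂ) * Complex.I, hR ?_, ?_⟩
    · simp only [Set.mem_ofPred_eq, norm_mul, Complex.norm_I, mul_one, Complex.norm_real]
      exact (le_abs_self R).trans ((le_add_of_nonneg_right zero_le_one).trans (le_abs_self _))
    · simp only [Set.mem_ofPred_eq, Complex.im_ofReal_mul, Complex.I_im, mul_one]
      positivity
  have h1 : p.coeff 0 = 1 := by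
    refine tendsto_nhds_unique (tendsto_const_nhds.congr' ?_) hlim
    filter_upwards [mem_inf_of_right (mem_principal_self _)] with z hz
    rw [hpz z hz, hpc, eval_C, coeff_C_zero]
  rw [hpz z hz, hpc, eval_C, h1]

theorem det_upper (hZ : IsRHPSolution n a V Z Zp Zm) (x : ℝ) : (Zp x).det = 1 := by
  have := mem_closure_iff_nhdsWithin_neBot.1 (ofReal_mem_closure_upper x)
  refine tendsto_nhds_unique (((continuous_id.matrix_det).tendsto _).comp (hZ.upper x))
    (tendsto_const_nhds.congr' ?_)
  exact eventually_mem_nhdsWithin.mono fun z hz => (hZ.det_eq_one (ne_of_gt hz)).symm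

theorem det_lower (hZ : IsRHPSolution n a V Z Zp Zm) (x : ℝ) : (Zm x).det = 1 := by
  have := mem_closure_iff_nhdsWithin_neBot.1 (ofReal_mem_closure_lower x)
  refine tendsto_nhds_unique (((continuous_id.matrix_det).tendsto _).comp (hZ.lower x))
    (tendsto_const_nhds.congr' ?_)
  exact eventually_mem_nhdsWithin.mono fun z hz => (hZ.det_eq_one (ne_of_lt hz)).symm

/-- The formula for the kernel, with its second argument off the real line. -/
theorem dualVec_inv_dotProduct (hr : r ≤ n) (hV : Continuous V) (hmom : FiniteMoments a V)
    (hB : IsUnit (matB n a V)) (hZ : IsRHPSolution n a V Z Zp Zm) {ζ : ℂ} (hζ : ζ.im ≠ 0) (x : ℝ) :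
    dualVec a ζ ⬝ᵥ (((Z ζ)⁻¹ * Zp x) *ᵥ Pi.single 0 1)
      = 2 * Real.pi * Complex.I * (x - ζ) * complexKernel n a V x ζ := by
  choose p hpd hpz hpx _ using hZ.exists_poly
  set φ : Fin (r + 2) → ℂ := dualVec a ζ ᵥ* (Z ζ)⁻¹ with hφ
  have hφZ : ∀ l, ∑ i, φ i * Z ζ i l = dualVec a ζ l := by
    intro l
    have : φ ᵥ* Z ζ = dualVec a ζ := by
      rw [hφ, Matrix.vecMul_vecMul, Matrix.nonsing_inv_mul _ (by rw [hZ.det_eq_one hζ]; simp),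
        Matrix.vecMul_one]
    exact congrFun this l
  set N : ℂ[X] := ∑ i, C (φ i) * p i with hN
  have hNev : ∀ z, N.eval z = ∑ i, φ i * (p i).eval z := fun z => by
    simp only [hN, eval_finsetSum, eval_mul, eval_C]
  have hlhs : dualVec a ζ ⬝ᵥ (((Z ζ)⁻¹ * Zp x) *ᵥ Pi.single 0 1) = N.eval (x : ℂ) := by
    rw [← Matrix.mulVec_mulVec, Matrix.dotProduct_mulVec, ← hφ, hNev, dotProduct]
    refine Finset.sum_congr rfl fun i _ => ?_
    rw [Matrix.mulVec_single_one, Matrix.col_apply, hpx]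
  -- At ζ the vector φ Z(ζ) is the dual vector, whose first entry is 0.
  have hNζ : N.IsRoot ζ := by
    rw [IsRoot, hNev, ← show dualVec a ζ 0 = 0 from rfl, ← hφZ 0]
    exact Finset.sum_congr rfl fun i _ => by rw [hpz i ζ hζ]
  have hpi : (2 * Real.pi * Complex.I : ℂ) ≠ 0 := by simp [Real.pi_ne_zero]
  set N₁ : ℂ[X] := N /ₘ (X - C ζ) with hN₁
  have hNfac : N = (X - C ζ) * N₁ := (mul_divByMonic_eq_iff_isRoot.2 hNζ).symm
  have hNd : N.degree < ((n + 1 : ℕ) : WithBot ℕ) := by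
    rw [← mem_degreeLT]
    refine Submodule.sum_mem _ fun i _ => ?_
    rw [mem_degreeLT, ← smul_eq_C_mul]
    exact (degree_smul_le _ _).trans_lt (hpd i)
  set Q : ℂ[X] := C (2 * Real.pi * Complex.I)⁻¹ * N₁ with hQ
  have hQd : Q.degree < n := by
    rw [hQ, ← smul_eq_C_mul]
    refine (degree_smul_le _ _).trans_lt ?_
    rcases eq_or_ne N₁ 0 with h | h
    · rw [h, degree_zero]; exact WithBot.bot_lt_coe _
    · rw [hNfac, degree_mul, degree_X_sub_C, degree_eq_natDegree h] at hNd
      rw [degree_eq_natDegree h]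
      have : 1 + N₁.natDegree < n + 1 := by exact_mod_cast hNd
      have : N₁.natDegree < n := by omega
      exact_mod_cast this
  have hne : ∀ x : ℝ, (x : ℂ) - ζ ≠ 0 := fun x h => hζ (by
    rw [← sub_eq_zero.1 h]; simp)
  have hQN : ∀ x : ℝ, N.eval (x : ℂ) / (x - ζ) = 2 * Real.pi * Complex.I * Q.eval (x : ℂ) := by
    intro x
    rw [div_eq_iff (hne x), hQ, hNfac, eval_mul, eval_mul, eval_C, eval_sub, eval_X, eval_C]
    field_simp
  -- Cauchy's formula for z^m times φ applied to a later column of Z. Its jump at x is x^m N(x)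
  -- times the weight, and its value at ζ is ζ^m times an entry of the dual vector.
  have key : ∀ (k : Fin (r + 1)) (m : ℕ),
      (∀ i, Tendsto (fun z => z ^ m * Z z i k.succ) offRealInfty (𝓝 0)) →
      ∫ x : ℝ, (x : ℂ) ^ m * Q.eval (x : ℂ) * (weight a V k x : ℂ)
        = ζ ^ m * dualVec a ζ k.succ := by
    intro k m hlim
    have hbd : ∀ (A : Set ℂ) (x : ℝ) (w : Fin (r + 2) → ℂ),
        (∀ i, Tendsto (fun z => Z z i k.succ) (𝓝[A] (x : ℂ)) (𝓝 (w i))) →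
        Tendsto (fun z => z ^ m * ∑ i, φ i * Z z i k.succ) (𝓝[A] (x : ℂ))
          (𝓝 ((x : ℂ) ^ m * ∑ i, φ i * w i)) := by
      intro A x w hw
      refine Tendsto.mul (((continuous_pow m).tendsto _).mono_left nhdsWithin_le_nhds) ?_
      exact tendsto_finsetSum _ fun i _ => (hw i).const_mul _
    have e : ∀ x : ℝ, ((x : ℂ) ^ m * ∑ i, φ i * Zp x i k.succ
        - (x : ℂ) ^ m * ∑ i, φ i * Zm x i k.succ) / (x - ζ)
        = (2 * Real.pi * Complex.I) * ((x : ℂ) ^ m * Q.eval (x : ℂ) * (weight a V k x : ℂ)) := by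
      intro x
      rw [← mul_sub, ← Finset.sum_sub_distrib]
      simp only [← mul_sub, hZ.jump_succ]
      simp only [← mul_assoc, ← Finset.sum_mul, hpx]
      rw [← hNev, div_eq_iff (hne x)]
      linear_combination ((x : ℂ) ^ m * (weight a V k x : ℂ)) * (div_eq_iff (hne x)).1 (hQN x)
    have hint : Integrable fun x : ℝ =>
        (x : ℂ) ^ m * Q.eval (x : ℂ) * (weight a V k x : ℂ) := by
      have := integrable_eval_ofReal (integrable_pow_mul_weight hmom k) ((X : ℂ[X]) ^ m * Q)
      refine this.congr (.of_forall fun x => ?_)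
      simp only [eval_mul, eval_pow, eval_X]
    have h := integral_jump_div (f := fun z => z ^ m * ∑ i, φ i * Z z i k.succ)
      ((differentiable_id.pow m).differentiableOn.mul (DifferentiableOn.fun_sum fun i _ =>
        (hZ.analytic i k.succ).const_mul _))
      (fun x => hbd _ x _ fun i => hZ.upper_apply x i _)
      (fun x => hbd _ x _ fun i => hZ.lower_apply x i _) hζ
      ((hint.const_mul _).congr (.of_forall fun x => (e x).symm))
      (by
        have h1 := tendsto_finsetSum Finset.univ fun i _ => (hlim i).const_mul (φ i)
        simp only [mul_zero, Finset.sum_const_zero] at h1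
        refine h1.congr fun z => ?_
        rw [Finset.mul_sum]
        exact Finset.sum_congr rfl fun i _ => by ring)
    rw [integral_congr_ae (.of_forall e), integral_const_mul] at h
    rw [mul_left_cancel₀ hpi h, hφZ]
  rw [hlhs, hNfac, eval_mul, eval_sub, eval_X, eval_C]
  have hfin := eval_eq_complexKernel hr hV hmom hB hQd (ζ := ζ) (fun m hm => by
    refine (key 0 m fun i => ?_).trans (mul_one _)
    -- The second column is O(z^{-(n-r)}), so multiplication by z^m with m < n - r leaves a factor
    -- z^{-(d+1)}.
    obtain ⟨d, hd⟩ := Nat.exists_eq_add_of_lt hm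
    have h1 := (hZ.tendsto_mul_zpow i (Fin.succ 0)).mul (tendsto_inv_offRealInfty.pow (d + 1))
    rw [zero_pow (Nat.succ_ne_zero d), mul_zero] at h1
    refine h1.congr' ((eventually_ne_offRealInfty 0).mono fun z hz => ?_)
    have h2 : -rhpExponent n r (Fin.succ 0) = ((m + (d + 1) : ℕ) : ℤ) := by
      change -(-(n : ℤ) + r) = _
      omega
    rw [h2, zpow_natCast, pow_add, inv_pow]
    field_simp) (fun j => by
    have h3 := key j.succ 0 fun i => by
      have h1 := (hZ.tendsto_mul_zpow i j.succ.succ).mul tendsto_inv_offRealInfty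
      rw [mul_zero] at h1
      refine h1.congr' ((eventually_ne_offRealInfty 0).mono fun z hz => ?_)
      have h2 : -rhpExponent n r j.succ.succ = 1 := by
        change -(-1 : ℤ) = 1
        norm_num
      simp only [h2, zpow_one, pow_zero, one_mul, mul_assoc, mul_inv_cancel₀ hz, mul_one]
    simp only [pow_zero, one_mul] at h3
    exact h3) x
  rw [← hfin, hQ, eval_mul, eval_C]
  field_simp

/-- With determinant 1 the inverse is the adjugate, which is polynomial in the entries. -/
theorem tendsto_inv (hZ : IsRHPSolution n a V Z Zp Zm) {A : Set ℂ} (hA : A ⊆ {z : ℂ | z.im ≠ 0})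
    {y : ℝ} {M : Matrix (Fin (r + 2)) (Fin (r + 2)) ℂ} (hM : M.det = 1)
    (h : Tendsto Z (𝓝[A] (y : ℂ)) (𝓝 M)) :
    Tendsto (fun z => (Z z)⁻¹) (𝓝[A] (y : ℂ)) (𝓝 M⁻¹) := by
  have hinv : ∀ M : Matrix (Fin (r + 2)) (Fin (r + 2)) ℂ, M.det = 1 → M⁻¹ = M.adjugate :=
    fun M hM => by rw [Matrix.inv_def, hM, Ring.inverse_one, one_smul]
  rw [hinv M hM]
  refine Tendsto.congr' (eventually_mem_nhdsWithin.mono fun z hz =>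
    (hinv _ (hZ.det_eq_one (hA hz))).symm) ?_
  exact ((continuous_id.matrix_adjugate).tendsto M).comp h

theorem continuous_dualVec (a : Fin r → ℝ) : Continuous (dualVec a) := by
  refine continuous_pi fun l => ?_
  refine Fin.cases continuous_const (fun k => Fin.cases continuous_const (fun j => ?_) k) l
  change Continuous fun ζ : ℂ => Complex.exp (a j * ζ)
  fun_prop

theorem dualVec_inv_dotProduct_of_tendsto (hr : r ≤ n) (hV : Continuous V)
    (hmom : FiniteMoments a V) (hB : IsUnit (matB n a V)) (hZ : IsRHPSolution n a V Z Zp Zm)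
    {A : Set ℂ} (hA : A ⊆ {z : ℂ | z.im ≠ 0}) {x y : ℝ} (hy : (y : ℂ) ∈ closure A)
    {M : Matrix (Fin (r + 2)) (Fin (r + 2)) ℂ} (hM : M.det = 1)
    (h : Tendsto Z (𝓝[A] (y : ℂ)) (𝓝 M)) :
    dualVec a y ⬝ᵥ ((M⁻¹ * Zp x) *ᵥ Pi.single 0 1)
      = 2 * Real.pi * Complex.I * (x - y) * complexKernel n a V x y := by
  have := mem_closure_iff_nhdsWithin_neBot.1 hy
  have hc : Continuous fun q : (Fin (r + 2) → ℂ) × Matrix (Fin (r + 2)) (Fin (r + 2)) ℂ =>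
      q.1 ⬝ᵥ ((q.2 * Zp x) *ᵥ Pi.single 0 1) :=
    continuous_fst.dotProduct ((continuous_snd.matrix_mul continuous_const).matrix_mulVec
      continuous_const)
  have h1 := (hc.tendsto _).comp
    ((((continuous_dualVec a).tendsto (y : ℂ)).mono_left nhdsWithin_le_nhds).prodMk_nhds
      (hZ.tendsto_inv hA hM h))
  have h2 : Continuous fun ζ : ℂ => 2 * Real.pi * Complex.I * (x - ζ) * complexKernel n a V x ζ := by
    have := continuous_complexKernel n a V x
    fun_prop
  refine tendsto_nhds_unique h1 (((h2.tendsto (y : ℂ)).mono_left nhdsWithin_le_nhds).congr' ?_)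
  exact eventually_mem_nhdsWithin.mono fun ζ hζ =>
    (hZ.dualVec_inv_dotProduct hr hV hmom hB (hA hζ) x).symm

/-- The side chosen at x is irrelevant because only the first column enters there and it has no
jump; at y the formula off the real line has the same limit from both half planes. -/
theorem kernel_eq (hr : r ≤ n) (hV : Continuous V) (hmom : FiniteMoments a V)
    (hB : IsUnit (matB n a V)) (hZ : IsRHPSolution n a V Z Zp Zm)
    {P Q : ℝ → Matrix (Fin (r + 2)) (Fin (r + 2)) ℂ} (hP : P = Zp ∨ P = Zm) (hQ : Q = Zp ∨ Q = Zm)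
    {x y : ℝ} (hxy : x ≠ y) :
    kernel a V P Q x y = (Real.exp (-V x) : ℂ) * complexKernel n a V x y := by
  have hQp : ((P y)⁻¹ * Q x) *ᵥ Pi.single 0 1 = ((P y)⁻¹ * Zp x) *ᵥ Pi.single 0 1 := by
    rw [← Matrix.mulVec_mulVec, ← Matrix.mulVec_mulVec]
    congr 1
    rw [Matrix.mulVec_single_one, Matrix.mulVec_single_one]
    rcases hQ with rfl | rfl
    · rfl
    · exact funext fun i => (hZ.jump_zero x i).symm
  have hu : (vecCons 0 (vecCons 1 fun j => (Real.exp (a j * y) : ℂ)) : Fin (r + 2) → ℂ)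
      = dualVec a y := by
    simp only [dualVec, Complex.ofReal_exp, Complex.ofReal_mul]
  have hmain : dualVec a y ⬝ᵥ (((P y)⁻¹ * Zp x) *ᵥ Pi.single 0 1)
      = 2 * Real.pi * Complex.I * (x - y) * complexKernel n a V x y := by
    rcases hP with rfl | rfl
    · exact hZ.dualVec_inv_dotProduct_of_tendsto hr hV hmom hB (fun z hz => ne_of_gt hz)
        (ofReal_mem_closure_upper y) (hZ.det_upper y) (hZ.upper y)
    · exact hZ.dualVec_inv_dotProduct_of_tendsto hr hV hmom hB (fun z hz => ne_of_lt hz)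
        (ofReal_mem_closure_lower y) (hZ.det_lower y) (hZ.lower y)
  have hpi : (Real.pi : ℂ) ≠ 0 := by exact_mod_cast Real.pi_ne_zero
  have hne : (x : ℂ) - y ≠ 0 := sub_ne_zero.2 (by exact_mod_cast hxy)
  rw [kernel, hQp, hu, hmain]
  have hI := Complex.I_ne_zero
  field_simp

end IsRHPSolution

end RiemannHilbert

/-! ### Hölder classes, boundary values of Cauchy transforms and their behaviour at infinity. -/

section CauchyTransform

/-- Exponential decay at rate `δ` of a function and of its local Hölder constants. -/
structure HolderBound (M α δ : ℝ) (g : ℝ → ℝ) : Prop where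
  bound : ∀ x, |g x| ≤ M * Real.exp (-δ * |x|)
  holder : ∀ x y, |x - y| ≤ 1 → |g x - g y| ≤ M * |x - y| ^ α * Real.exp (-δ * |x|)

/-- Exponentially decaying functions that are Hölder continuous with exponentially decaying local
Hölder constants. -/
def HolderClass (g : ℝ → ℝ) : Prop :=
  ∃ M α δ : ℝ, 0 < α ∧ α ≤ 1 ∧ 0 < δ ∧ HolderBound M α δ g

namespace HolderBound

variable {M α δ : ℝ} {g : ℝ → ℝ}

theorem nonneg (hg : HolderBound M α δ g) : 0 ≤ M := by
  have := (abs_nonneg _).trans (hg.bound 0)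
  exact nonneg_of_mul_nonneg_left this (Real.exp_pos _)

theorem mono (hg : HolderBound M α δ g) {α' δ' : ℝ} (hα' : 0 < α') (hα : α' ≤ α) (hδ : δ' ≤ δ) :
    HolderBound M α' δ' g := by
  have hM := hg.nonneg
  refine ⟨fun x => (hg.bound x).trans (by gcongr), fun x y hxy => ?_⟩
  refine (hg.holder x y hxy).trans ?_
  have : |x - y| ^ α ≤ |x - y| ^ α' :=
    Real.rpow_le_rpow_of_exponent_ge_of_imp (abs_nonneg _) hxy hα
      fun _ h => absurd h (hα'.trans_le hα).ne'
  gcongr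

/-- The multiplier may grow like e^{b|x|}, which costs b in the decay rate. Its Lipschitz bound
implies a Hölder bound at distance at most 1 because α ≤ 1. -/
theorem mul (hg : HolderBound M α δ g) (hδ : 0 ≤ δ) (hα : α ≤ 1) {h : ℝ → ℝ}
    {C b : ℝ} (hh : ∀ x, |h x| ≤ C * Real.exp (b * |x|))
    (hh' : ∀ x y, |x - y| ≤ 1 → |h x - h y| ≤ C * Real.exp (b * |x|) * |x - y|) :
    HolderBound (C * M * (1 + Real.exp δ)) α (δ - b) (fun x => h x * g x) := by
  have hM := hg.nonneg
  have hC : 0 ≤ C := nonneg_of_mul_nonneg_left ((abs_nonneg _).trans (hh 0)) (Real.exp_pos _)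
  have hexp : ∀ x : ℝ, Real.exp (-(δ - b) * |x|)
      = Real.exp (b * |x|) * Real.exp (-δ * |x|) := fun x => by
    rw [← Real.exp_add]; ring_nf
  constructor
  · intro x
    rw [abs_mul, hexp]
    calc |h x| * |g x| ≤ (C * Real.exp (b * |x|)) * (M * Real.exp (-δ * |x|)) := by
          gcongr
          exacts [hh x, hg.bound x]
      _ = C * M * 1 * (Real.exp (b * |x|) * Real.exp (-δ * |x|)) := by ring
      _ ≤ _ := by
          gcongr
          linarith [Real.exp_pos δ]
  · intro x y hxy
    have h1 : |x - y| ≤ |x - y| ^ α :=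
      Real.self_le_rpow_of_le_one (abs_nonneg _) hxy hα
    -- Moving the decay from y to x, at distance at most 1, costs the factor e^δ.
    have h2 : |g y| ≤ M * (Real.exp δ * Real.exp (-δ * |x|)) := by
      refine (hg.bound y).trans ?_
      rw [← Real.exp_add]
      gcongr
      have := abs_sub_abs_le_abs_sub x y
      nlinarith
    have h3 : h x * g x - h y * g y = h x * (g x - g y) + (h x - h y) * g y := by ring
    rw [h3, hexp]
    calc |h x * (g x - g y) + (h x - h y) * g y|
        ≤ |h x| * |g x - g y| + |h x - h y| * |g y| := by
          rw [← abs_mul, ← abs_mul]; exact abs_add_le _ _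
      _ ≤ (C * Real.exp (b * |x|)) * (M * |x - y| ^ α * Real.exp (-δ * |x|))
          + (C * Real.exp (b * |x|) * |x - y| ^ α) * (M * (Real.exp δ * Real.exp (-δ * |x|))) := by
          gcongr
          · exact hh x
          · exact hg.holder x y hxy
          · exact (hh' x y hxy).trans (by gcongr)
      _ = _ := by ring

theorem add {M' : ℝ} {g' : ℝ → ℝ} (hg : HolderBound M α δ g) (hg' : HolderBound M' α δ g') :
    HolderBound (M + M') α δ (fun x => g x + g' x) := by
  constructor
  · intro x
    calc |g x + g' x| ≤ |g x| + |g' x| := abs_add_le _ _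
      _ ≤ _ := by rw [add_mul]; exact add_le_add (hg.bound x) (hg'.bound x)
  · intro x y hxy
    calc |g x + g' x - (g y + g' y)| = |(g x - g y) + (g' x - g' y)| := by ring_nf
      _ ≤ |g x - g y| + |g' x - g' y| := abs_add_le _ _
      _ ≤ _ := by
        rw [add_mul, add_mul]
        exact add_le_add (hg.holder x y hxy) (hg'.holder x y hxy)

theorem continuous (hg : HolderBound M α δ g) (hα : 0 < α) : Continuous g := by
  rw [continuous_iff_continuousAt]
  intro x
  rw [ContinuousAt, tendsto_iff_norm_sub_tendsto_zero]
  have h1 : Tendsto (fun y => M * |x - y| ^ α * Real.exp (-δ * |x|)) (𝓝 x) (𝓝 0) := by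
    have : Continuous fun y => M * |x - y| ^ α * Real.exp (-δ * |x|) := by
      have := (continuous_const.sub continuous_id).abs.rpow_const (f := fun y => |x - y|)
        (p := α) fun _ => Or.inr hα.le
      fun_prop
    have h2 := this.tendsto x
    simpa [Real.zero_rpow hα.ne'] using h2
  refine squeeze_zero' (.of_forall fun _ => norm_nonneg _) ?_ h1
  filter_upwards [Metric.closedBall_mem_nhds x one_pos] with y hy
  rw [Real.norm_eq_abs, abs_sub_comm]
  exact hg.holder x y (by rwa [abs_sub_comm, ← Real.dist_eq])

end HolderBound

theorem integrable_comp_abs {f : ℝ → ℝ} (hf : IntegrableOn f (Set.Ioi 0)) :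
    Integrable fun x => f |x| := by
  have h1 : IntegrableOn (fun x => f |x|) (Set.Ioi 0) :=
    hf.congr_fun (fun x hx => by simp only [abs_of_pos (show 0 < x from hx)]) measurableSet_Ioi
  have h2 : IntegrableOn (fun x => f |x|) (Set.Iic 0) := by
    rw [integrableOn_Iic_iff_integrableOn_Iio]
    have := h1.comp_neg
    simpa using this
  rw [← integrableOn_univ, ← Set.Iic_union_Ioi (a := (0 : ℝ))]
  exact h2.union h1

theorem integrable_exp_neg_mul_abs {δ : ℝ} (hδ : 0 < δ) :
    Integrable fun x : ℝ => Real.exp (-δ * |x|) :=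
  integrable_comp_abs (f := fun t => Real.exp (-δ * t)) (exp_neg_integrableOn_Ioi 0 hδ)

theorem integrable_indicator_abs_rpow {α : ℝ} (hα : 0 < α) :
    Integrable ((Set.Icc (-1 : ℝ) 1).indicator fun u => |u| ^ (α - 1)) := by
  have h1 : IntegrableOn ((Set.Iic (1 : ℝ)).indicator fun t => t ^ (α - 1)) (Set.Ioi 0) := by
    rw [IntegrableOn, integrable_indicator_iff measurableSet_Iic, IntegrableOn,
      Measure.restrict_restrict measurableSet_Iic, Set.inter_comm, Set.Ioi_inter_Iic]
    exact (intervalIntegrable_iff_integrableOn_Ioc_of_le zero_le_one).1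
      (intervalIntegral.intervalIntegrable_rpow' (by linarith))
  refine (integrable_comp_abs h1).congr (.of_forall fun u => ?_)
  simp only [Set.indicator, Set.mem_Iic, Set.mem_Icc, abs_le]

theorem HolderBound.integrable {M α δ : ℝ} {g : ℝ → ℝ} (hg : HolderBound M α δ g) (hα : 0 < α)
    (hδ : 0 < δ) : Integrable g :=
  ((integrable_exp_neg_mul_abs hδ).const_mul M).mono' (hg.continuous hα).aestronglyMeasurable
    (.of_forall hg.bound)

namespace HolderClass

variable {g : ℝ → ℝ}

theorem integrable (hg : HolderClass g) : Integrable g := by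
  obtain ⟨M, α, δ, hα, -, hδ, h⟩ := hg
  exact h.integrable hα hδ

theorem continuous (hg : HolderClass g) : Continuous g := by
  obtain ⟨M, α, δ, hα, -, hδ, h⟩ := hg
  exact h.continuous hα

theorem add {g' : ℝ → ℝ} (hg : HolderClass g) (hg' : HolderClass g') :
    HolderClass fun x => g x + g' x := by
  obtain ⟨M, α, δ, hα, hα1, hδ, h⟩ := hg
  obtain ⟨M', α', δ', hα', hα1', hδ', h'⟩ := hg'
  have hm : 0 < min α α' := lt_min hα hα'
  exact ⟨M + M', min α α', min δ δ', hm, (min_le_left _ _).trans hα1, lt_min hδ hδ',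
    (h.mono hm (min_le_left _ _) (min_le_left _ _)).add
      (h'.mono hm (min_le_right _ _) (min_le_right _ _))⟩

theorem const_mul (hg : HolderClass g) (c : ℝ) : HolderClass fun x => c * g x := by
  obtain ⟨M, α, δ, hα, hα1, hδ, h⟩ := hg
  refine ⟨_, α, δ - 0, hα, hα1, by simpa, h.mul hδ.le hα1 (C := |c|) (b := 0) ?_ ?_⟩
  · simp
  · intro x y _
    simp only [sub_self, abs_zero]
    positivity

theorem id_mul (hg : HolderClass g) : HolderClass fun x => x * g x := by
  obtain ⟨M, α, δ, hα, hα1, hδ, h⟩ := hg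
  have hb : 0 < δ / 2 := by positivity
  have hexp : ∀ x : ℝ, 1 ≤ Real.exp (δ / 2 * |x|) := fun x => Real.one_le_exp (by positivity)
  refine ⟨_, α, δ - δ / 2, hα, hα1, by linarith,
    h.mul hδ.le hα1 (C := (δ / 2)⁻¹ + 1) (b := δ / 2) (h := fun x => x) ?_ ?_⟩
  · intro x
    have h1 : δ / 2 * |x| ≤ Real.exp (δ / 2 * |x|) := by
      linarith [Real.add_one_le_exp (δ / 2 * |x|)]
    have h2 : |x| ≤ (δ / 2)⁻¹ * Real.exp (δ / 2 * |x|) := by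
      rw [inv_mul_eq_div, le_div_iff₀ hb]; linarith
    linarith [hexp x]
  · intro x y _
    have h1 : 1 ≤ ((δ / 2)⁻¹ + 1) * Real.exp (δ / 2 * |x|) := by
      have : 0 < (δ / 2)⁻¹ := by positivity
      nlinarith [hexp x]
    exact le_mul_of_one_le_left (abs_nonneg _) h1

theorem pow_mul (hg : HolderClass g) (m : ℕ) : HolderClass fun x => x ^ m * g x := by
  induction m with
  | zero => simpa using hg
  | succ m ih =>
    have := ih.id_mul
    simpa only [pow_succ', mul_assoc] using this

theorem eval_mul (hg : HolderClass g) (p : ℝ[X]) : HolderClass fun x => p.eval x * g x := by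
  induction p using Polynomial.induction_on' with
  | add p q hp hq => simpa only [eval_add, add_mul] using hp.add hq
  | monomial m c => simpa only [eval_monomial, mul_assoc] using (hg.pow_mul m).const_mul c

end HolderClass

theorem abs_exp_sub_one_le_mul (t : ℝ) : |Real.exp t - 1| ≤ |t| * Real.exp |t| := by
  have h1 := Real.add_one_le_exp t
  have h2 := Real.add_one_le_exp (-t)
  have h3 : Real.exp t * Real.exp (-t) = 1 := by rw [← Real.exp_add]; simp
  have h4 := Real.exp_pos t
  rcases le_total 0 t with h | h
  · rw [abs_of_nonneg h, abs_of_nonneg (by linarith)]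
    nlinarith
  · rw [abs_of_nonpos h, abs_of_nonpos (by linarith [Real.exp_le_one_iff.2 h])]
    nlinarith [Real.one_le_exp (neg_nonneg.2 h)]

theorem holderClass_weight {r : ℕ} {a : Fin r → ℝ} {V : ℝ → ℝ} (h : HolderDecay a V)
    (k : Fin (r + 1)) : HolderClass (weight a V k) := by
  obtain ⟨M, α, c, hα, hc, hac, hb, hh⟩ := h
  have h0 : HolderBound M α c (fun x => Real.exp (-V x)) :=
    ⟨fun x => by rw [abs_of_pos (Real.exp_pos _)]; exact hb x, hh⟩
  -- The exponent is capped at 1 so that products with the Lipschitz factors e^{a_j x} can be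
  -- formed; these leave the decay rate c - |a_j| > 0.
  have hα' : 0 < min α 1 := lt_min hα one_pos
  have h1 := h0.mono hα' (min_le_left _ _) le_rfl
  refine Fin.cases ⟨M, min α 1, c, hα', min_le_right _ _, hc, h1⟩ (fun j => ?_) k
  have h2 := h1.mul hc.le (min_le_right _ _) (h := fun x => Real.exp (a j * x))
    (C := (|a j| + 1) * Real.exp |a j|) (b := |a j|) (fun x => by
      rw [abs_of_pos (Real.exp_pos _)]
      have h3 : Real.exp (a j * x) ≤ Real.exp (|a j| * |x|) := by
        rw [← abs_mul]; exact Real.exp_le_exp.2 (le_abs_self _)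
      refine h3.trans (le_mul_of_one_le_left (Real.exp_pos _).le ?_)
      have := Real.one_le_exp (abs_nonneg (a j))
      nlinarith [abs_nonneg (a j)]) (fun x y hxy => by
      have e : Real.exp (a j * x) - Real.exp (a j * y)
          = -(Real.exp (a j * x) * (Real.exp (a j * (y - x)) - 1)) := by
        rw [mul_sub, ← Real.exp_add]; ring_nf
      rw [e, abs_neg, abs_mul, abs_of_pos (Real.exp_pos _)]
      have h3 : Real.exp (a j * x) ≤ Real.exp (|a j| * |x|) := by
        rw [← abs_mul]; exact Real.exp_le_exp.2 (le_abs_self _)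
      have h4 := abs_exp_sub_one_le_mul (a j * (y - x))
      have h5 : |a j * (y - x)| ≤ |a j| := by
        rw [abs_mul, abs_sub_comm]
        exact mul_le_of_le_one_right (abs_nonneg _) hxy
      calc Real.exp (a j * x) * |Real.exp (a j * (y - x)) - 1|
          ≤ Real.exp (|a j| * |x|) * (|a j * (y - x)| * Real.exp |a j|) := by
            gcongr
            exact h4.trans (by gcongr)
        _ = |a j| * Real.exp |a j| * Real.exp (|a j| * |x|) * |x - y| := by
            rw [abs_mul, abs_sub_comm]; ring
        _ ≤ _ := by
            gcongr
            linarith)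
  have e : weight a V j.succ = fun x => Real.exp (a j * x) * Real.exp (-V x) := by
    funext x
    change Real.exp (-V x + a j * x) = _
    rw [add_comm, Real.exp_add]
  exact ⟨_, min α 1, c - |a j|, hα', min_le_right _ _, sub_pos.2 (hac j), e ▸ h2⟩

/-- The Cauchy transform `∫ g(s) / (s - z) ds`. -/
noncomputable def cauchyTransform (g : ℝ → ℝ) (z : ℂ) : ℂ :=
  ∫ s : ℝ, (g s : ℂ) / (s - z)

theorem abs_im_le_norm_ofReal_sub (s : ℝ) (z : ℂ) : |z.im| ≤ ‖(s : ℂ) - z‖ := by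
  have := Complex.abs_im_le_norm ((s : ℂ) - z)
  simpa using this

theorem ofReal_sub_ne_zero (s : ℝ) {z : ℂ} (hz : z.im ≠ 0) : (s : ℂ) - z ≠ 0 :=
  norm_pos_iff.1 ((abs_pos.2 hz).trans_le (abs_im_le_norm_ofReal_sub s z))

theorem continuous_inv_ofReal_sub {z : ℂ} (hz : z.im ≠ 0) :
    Continuous fun s : ℝ => ((s : ℂ) - z)⁻¹ :=
  (Complex.continuous_ofReal.sub continuous_const).inv₀ fun s => ofReal_sub_ne_zero s hz

theorem integrable_div_ofReal_sub {g : ℝ → ℝ} (hg : Integrable g) {z : ℂ} (hz : z.im ≠ 0) :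
    Integrable fun s : ℝ => (g s : ℂ) / (s - z) := by
  simp only [div_eq_mul_inv]
  refine hg.ofReal.mul_bdd (c := |z.im|⁻¹) (continuous_inv_ofReal_sub hz).aestronglyMeasurable
    (.of_forall fun s => ?_)
  rw [norm_inv]
  exact inv_anti₀ (abs_pos.2 hz) (abs_im_le_norm_ofReal_sub s z)

theorem differentiableOn_cauchyTransform {g : ℝ → ℝ} (hg : Integrable g) :
    DifferentiableOn ℂ (cauchyTransform g) {z : ℂ | z.im ≠ 0} := by
  intro z₀ hz₀
  have hz₀' : 0 < |z₀.im| := abs_pos.2 hz₀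
  -- On this ball all denominators exceed |Im z₀| / 2, which dominates the differentiated integrand.
  have hball : ∀ z ∈ Metric.ball z₀ (|z₀.im| / 2), |z₀.im| / 2 < |z.im| := by
    intro z hz
    rw [Metric.mem_ball, dist_eq_norm] at hz
    have h1 := (Complex.abs_im_le_norm (z - z₀)).trans_lt hz
    rw [Complex.sub_im, abs_sub_comm] at h1
    have h2 := abs_sub_abs_le_abs_sub z₀.im z.im
    linarith
  have hball' : ∀ z ∈ Metric.ball z₀ (|z₀.im| / 2), z.im ≠ 0 := fun z hz =>
    abs_pos.1 ((by positivity : (0 : ℝ) < |z₀.im| / 2).trans (hball z hz))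
  have hnhds := Metric.ball_mem_nhds z₀ (show 0 < |z₀.im| / 2 by positivity)
  refine (HasDerivAt.differentiableAt (hasDerivAt_integral_of_dominated_loc_of_deriv_le
    (F' := fun z s => (g s : ℂ) / ((s : ℂ) - z) ^ 2)
    (bound := fun s => |g s| * ((|z₀.im| / 2) ^ 2)⁻¹) hnhds
    (Filter.mem_of_superset hnhds fun z hz =>
      (integrable_div_ofReal_sub hg (hball' z hz)).aestronglyMeasurable)
    (integrable_div_ofReal_sub hg hz₀) ?_ (.of_forall fun s z hz => ?_)
    (hg.abs.mul_const _) (.of_forall fun s z hz => ?_)).2).differentiableWithinAt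
  · simp only [div_eq_mul_inv, ← inv_pow]
    exact hg.ofReal.aestronglyMeasurable.mul
      ((continuous_inv_ofReal_sub hz₀).pow 2).aestronglyMeasurable
  · rw [norm_div, norm_pow, Complex.norm_real, Real.norm_eq_abs, div_eq_mul_inv]
    have := (hball z hz).le.trans (abs_im_le_norm_ofReal_sub s z)
    gcongr
  · have h1 : HasDerivAt (fun z : ℂ => (s : ℂ) - z) (-1) z := by
      simpa using (hasDerivAt_id z).const_sub (s : ℂ)
    have h2 := (h1.inv (ofReal_sub_ne_zero s (hball' z hz))).const_mul (g s : ℂ)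
    simp only [div_eq_mul_inv] at h2 ⊢
    exact h2.congr_deriv (by ring)

/-- The integral of `1 / (u - iε)` over `[-1, 1]`. -/
noncomputable def logJump (ε : ℝ) : ℂ :=
  Complex.log (1 - ε * Complex.I) - Complex.log (-1 - ε * Complex.I)

theorem integral_inv_sub_eq_logJump {ε : ℝ} (hε : ε ≠ 0) :
    ∫ u in (-1 : ℝ)..1, ((u : ℂ) - ε * Complex.I)⁻¹ = logJump ε := by
  have him : (ε * Complex.I : ℂ).im ≠ 0 := by simpa using hε
  rw [intervalIntegral.integral_eq_sub_of_hasDerivAt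
    (f := fun u : ℝ => Complex.log ((u : ℂ) - ε * Complex.I)) (fun u _ => ?_)
    ((continuous_inv_ofReal_sub him).intervalIntegrable _ _)]
  · simp [logJump]
  · have h1 : HasDerivAt (fun u : ℝ => (u : ℂ) - ε * Complex.I) 1 u :=
      (Complex.ofRealCLM.hasDerivAt).sub_const _
    have h2 := h1.clog_real (Complex.mem_slitPlane_iff.2 (Or.inr (by simpa using hε)))
    simpa only [one_div] using h2

/-- Both arguments of the logarithm have the same modulus, so only the difference of the arguments
remains. -/
theorem norm_logJump_le (ε : ℝ) : ‖logJump ε‖ ≤ 2 * Real.pi := by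
  have hn : ‖(1 - ε * Complex.I : ℂ)‖ = ‖(-1 - ε * Complex.I : ℂ)‖ := by
    simp [Complex.norm_def, Complex.normSq_apply]
  have hre : (logJump ε).re = 0 := by
    rw [logJump, Complex.sub_re, Complex.log_re, Complex.log_re, hn, sub_self]
  have him : |(logJump ε).im| ≤ 2 * Real.pi := by
    rw [logJump, Complex.sub_im, Complex.log_im, Complex.log_im]
    refine (abs_sub _ _).trans ?_
    linarith [Complex.abs_arg_le_pi (1 - ε * Complex.I), Complex.abs_arg_le_pi (-1 - ε * Complex.I)]
  refine (Complex.norm_le_abs_re_add_abs_im _).trans ?_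
  rw [hre, abs_zero, zero_add]
  exact him

theorem tendsto_log_one_sub (x : ℝ) :
    Tendsto (fun z : ℂ => Complex.log (1 - z.im * Complex.I)) (𝓝 (x : ℂ)) (𝓝 0) := by
  have h1 : Continuous fun z : ℂ => (1 - z.im * Complex.I : ℂ) := by fun_prop
  have h2 := h1.tendsto (x : ℂ)
  simp only [Complex.ofReal_im, Complex.ofReal_zero, zero_mul, sub_zero] at h2
  have h3 := h2.clog Complex.one_mem_slitPlane
  rwa [Complex.log_one] at h3

theorem tendsto_neg_one_sub {A B : Set ℂ} (x : ℝ)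
    (hAB : ∀ z ∈ A, (-1 - z.im * Complex.I : ℂ) ∈ B) :
    Tendsto (fun z : ℂ => (-1 - z.im * Complex.I : ℂ)) (𝓝[A] (x : ℂ)) (𝓝[B] (-1)) := by
  refine tendsto_nhdsWithin_iff.2 ⟨?_, eventually_mem_nhdsWithin.mono hAB⟩
  have h1 : Continuous fun z : ℂ => (-1 - z.im * Complex.I : ℂ) := by fun_prop
  have h2 := h1.tendsto (x : ℂ)
  simp only [Complex.ofReal_im, Complex.ofReal_zero, zero_mul, sub_zero] at h2
  exact h2.mono_left nhdsWithin_le_nhds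

/-- For Im z > 0 the point -1 - i Im z approaches the cut from below, where the logarithm tends to
-πi. -/
theorem tendsto_logJump_upper (x : ℝ) :
    Tendsto (fun z : ℂ => logJump z.im) (𝓝[{z : ℂ | 0 < z.im}] (x : ℂ))
      (𝓝 (Real.pi * Complex.I)) := by
  have h1 := (Complex.tendsto_log_nhdsWithin_im_neg_of_re_neg_of_im_zero (z := -1) (by simp)
    (by simp)).comp (tendsto_neg_one_sub (A := {z : ℂ | 0 < z.im}) x fun z hz => by simpa using hz)
  have h2 := ((tendsto_log_one_sub x).mono_left nhdsWithin_le_nhds).sub h1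
  simpa [logJump] using h2

theorem tendsto_logJump_lower (x : ℝ) :
    Tendsto (fun z : ℂ => logJump z.im) (𝓝[{z : ℂ | z.im < 0}] (x : ℂ))
      (𝓝 (-(Real.pi * Complex.I))) := by
  have h1 := (Complex.tendsto_log_nhdsWithin_im_nonneg_of_re_neg_of_im_zero (z := -1) (by simp)
    (by simp)).comp (tendsto_neg_one_sub (A := {z : ℂ | z.im < 0}) x fun z hz => by
      simpa using (show z.im < 0 from hz).le)
  have h2 := ((tendsto_log_one_sub x).mono_left nhdsWithin_le_nhds).sub h1
  simpa [logJump] using h2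

/-- The integrand of the Cauchy transform at `x + iε`, with its singularity removed. -/
noncomputable def regIntegrand (g : ℝ → ℝ) (x ε u : ℝ) : ℂ :=
  ((g (x + u) - (Set.Icc (-1 : ℝ) 1).indicator (fun _ => g x) u : ℝ) : ℂ) / (u - ε * Complex.I)

theorem abs_le_norm_ofReal_sub_mul_I (u ε : ℝ) : |u| ≤ ‖(u : ℂ) - ε * Complex.I‖ := by
  have := Complex.abs_re_le_norm ((u : ℂ) - ε * Complex.I)
  simpa using this

theorem integrable_indicator_const (c : ℝ) :
    Integrable ((Set.Icc (-1 : ℝ) 1).indicator fun _ => c) :=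
  (integrable_indicator_iff measurableSet_Icc).2 (integrableOn_const (by simp))

/-- Centre the integral at Re z and subtract g(Re z) on [-1, 1]. All dependence on the side of the
real line in the limit is then carried by the explicit logarithmic term. -/
theorem cauchyTransform_eq {g : ℝ → ℝ} (hg : Integrable g) {z : ℂ} (hz : z.im ≠ 0) :
    cauchyTransform g z = (∫ u, regIntegrand g z.re z.im u) + g z.re * logJump z.im := by
  have him : (z.im * Complex.I : ℂ).im ≠ 0 := by simpa using hz
  have h1 : cauchyTransform g z = ∫ u : ℝ, (g (z.re + u) : ℂ) / (u - z.im * Complex.I) := by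
    rw [cauchyTransform, ← integral_add_left_eq_self _ z.re]
    congr 1 with u
    congr 1
    rw [Complex.ofReal_add]
    nth_rw 2 [← Complex.re_add_im z]
    ring
  have hi1 : Integrable fun u : ℝ => (g (z.re + u) : ℂ) / (u - z.im * Complex.I) :=
    integrable_div_ofReal_sub (hg.comp_add_left z.re) him
  have hi2 : Integrable fun u : ℝ =>
      (((Set.Icc (-1 : ℝ) 1).indicator (fun _ => g z.re) u : ℝ) : ℂ) / (u - z.im * Complex.I) :=
    integrable_div_ofReal_sub (integrable_indicator_const _) him
  have h2 : ∫ u : ℝ, (((Set.Icc (-1 : ℝ) 1).indicator (fun _ => g z.re) u : ℝ) : ℂ)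
      / (u - z.im * Complex.I) = g z.re * logJump z.im := by
    rw [← integral_inv_sub_eq_logJump hz, intervalIntegral.integral_of_le (by norm_num),
      ← integral_Icc_eq_integral_Ioc, ← integral_const_mul, ← integral_indicator measurableSet_Icc]
    congr 1 with u
    by_cases hu : u ∈ Set.Icc (-1 : ℝ) 1
    · simp only [Set.indicator_of_mem hu, div_eq_mul_inv]
    · simp only [Set.indicator_of_notMem hu, Complex.ofReal_zero, zero_div]
  rw [h1, ← h2]
  simp only [regIntegrand, Complex.ofReal_sub, sub_div]
  rw [integral_sub hi1 hi2, sub_add_cancel]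

/-- Inside [-1, 1] the Hölder bound beats the singularity, leaving the integrable |u|^{α-1};
outside, the denominator is at least 1. The bound does not depend on ε. -/
theorem HolderBound.norm_regIntegrand_le {M α δ : ℝ} {g : ℝ → ℝ} (hg : HolderBound M α δ g)
    (hδ : 0 ≤ δ) (x ε u : ℝ) : ‖regIntegrand g x ε u‖
      ≤ M * (Set.Icc (-1 : ℝ) 1).indicator (fun u => |u| ^ (α - 1)) u + |g (x + u)| := by
  have hM := hg.nonneg
  rw [regIntegrand, norm_div, Complex.norm_real, Real.norm_eq_abs]
  have hden := abs_le_norm_ofReal_sub_mul_I u ε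
  by_cases hu : u ∈ Set.Icc (-1 : ℝ) 1
  · rw [Set.indicator_of_mem hu, Set.indicator_of_mem hu]
    rcases eq_or_ne u 0 with rfl | hu0
    · simp only [add_zero, sub_self, abs_zero, zero_div]
      positivity
    · have hpos : 0 < |u| := abs_pos.2 hu0
      refine le_add_of_le_of_nonneg ?_ (abs_nonneg _)
      have h1 := hg.holder x (x + u) (by rw [sub_add_cancel_left, abs_neg]; exact abs_le.2 hu)
      rw [sub_add_cancel_left, abs_neg, abs_sub_comm] at h1
      rw [div_le_iff₀ (hpos.trans_le hden)]
      calc |g (x + u) - g x| ≤ M * |u| ^ α * Real.exp (-δ * |x|) := h1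
        _ ≤ M * |u| ^ α * 1 := by
            gcongr
            rw [Real.exp_le_one_iff]
            nlinarith [abs_nonneg x]
        _ = M * |u| ^ (α - 1) * |u| := by
            rw [mul_one, mul_assoc, ← Real.rpow_add_one hpos.ne', sub_add_cancel]
        _ ≤ _ := by gcongr
  · rw [Set.indicator_of_notMem hu, Set.indicator_of_notMem hu, sub_zero, mul_zero, zero_add]
    refine div_le_self (abs_nonneg _) (le_trans ?_ hden)
    rw [Set.mem_Icc, ← abs_le, not_le] at hu
    exact hu.le

theorem aestronglyMeasurable_regIntegrand {g : ℝ → ℝ} (hg : Continuous g) (x ε : ℝ) :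
    AEStronglyMeasurable (regIntegrand g x ε) := by
  have h1 : Measurable ((Set.Icc (-1 : ℝ) 1).indicator fun _ => g x) :=
    measurable_const.indicator measurableSet_Icc
  have h2 : Measurable fun u : ℝ => g (x + u) := (hg.comp (continuous_const_add x)).measurable
  refine Measurable.aestronglyMeasurable ?_
  unfold regIntegrand
  fun_prop

namespace HolderClass

variable {g : ℝ → ℝ}

theorem exists_norm_cauchyTransform_le (hg : HolderClass g) :
    ∃ B, ∀ z : ℂ, z.im ≠ 0 → ‖cauchyTransform g z‖ ≤ B := by
  have hint := hg.integrable
  have hcont := hg.continuous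
  obtain ⟨M, α, δ, hα, -, hδ, h⟩ := hg
  refine ⟨M * (∫ u, (Set.Icc (-1 : ℝ) 1).indicator (fun u => |u| ^ (α - 1)) u) + (∫ u, |g u|)
    + M * (2 * Real.pi), fun z hz => ?_⟩
  rw [cauchyTransform_eq hint hz]
  have hi := (integrable_indicator_abs_rpow hα).const_mul M
  have hi2 := (hint.comp_add_left z.re).abs
  refine (norm_add_le _ _).trans (add_le_add ?_ ?_)
  · refine (norm_integral_le_of_norm_le (hi.add hi2)
      (.of_forall fun u => h.norm_regIntegrand_le hδ.le z.re z.im u)).trans_eq ?_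
    simp only [Pi.add_apply]
    rw [integral_add hi hi2, integral_const_mul,
      integral_add_left_eq_self (fun u => |g u|) z.re]
  · rw [norm_mul, Complex.norm_real, Real.norm_eq_abs]
    have hM := h.nonneg
    refine mul_le_mul ((h.bound _).trans ?_) (norm_logJump_le _) (norm_nonneg _) hM
    refine mul_le_of_le_one_right hM (Real.exp_le_one_iff.2 ?_)
    nlinarith [abs_nonneg z.re]

/-- The Plemelj formula, in a form that serves both sides: the regularised integral converges by
dominated convergence, to the same limit from above and below, and only L = ±πi differs. -/
theorem tendsto_cauchyTransform (hg : HolderClass g) {A : Set ℂ} (hA : A ⊆ {z : ℂ | z.im ≠ 0})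
    {x : ℝ} {L : ℂ} (hL : Tendsto (fun z : ℂ => logJump z.im) (𝓝[A] (x : ℂ)) (𝓝 L)) :
    Tendsto (cauchyTransform g) (𝓝[A] (x : ℂ)) (𝓝 ((∫ u, regIntegrand g x 0 u) + g x * L)) := by
  have hint := hg.integrable
  have hcont := hg.continuous
  obtain ⟨M, α, δ, hα, -, hδ, h⟩ := hg
  have hM := h.nonneg
  have hre : Tendsto (fun z : ℂ => z.re) (𝓝[A] (x : ℂ)) (𝓝 x) :=
    (Complex.continuous_re.tendsto (x : ℂ)).mono_left nhdsWithin_le_nhds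
  have him : Tendsto (fun z : ℂ => z.im) (𝓝[A] (x : ℂ)) (𝓝 0) :=
    (Complex.continuous_im.tendsto (x : ℂ)).mono_left nhdsWithin_le_nhds
  have hdct : Tendsto (fun z : ℂ => ∫ u, regIntegrand g z.re z.im u) (𝓝[A] (x : ℂ))
      (𝓝 (∫ u, regIntegrand g x 0 u)) := by
    -- The approach is not only vertical, so the majorant must be uniform in Re z: the factor
    -- e^{δ(|x|+1)} comes from |Re z| ≤ |x| + 1.
    refine tendsto_integral_filter_of_dominated_convergence
      (fun u => M * (Set.Icc (-1 : ℝ) 1).indicator (fun u => |u| ^ (α - 1)) u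
        + M * Real.exp (δ * (|x| + 1)) * Real.exp (-δ * |u|))
      (.of_forall fun z => aestronglyMeasurable_regIntegrand hcont _ _) ?_
      (((integrable_indicator_abs_rpow hα).const_mul M).add
        ((integrable_exp_neg_mul_abs hδ).const_mul _)) ?_
    · filter_upwards [hre.abs.eventually_le_const (lt_add_one |x|)] with z hz
      refine .of_forall fun u => (h.norm_regIntegrand_le hδ.le _ _ u).trans ?_
      gcongr
      refine (h.bound _).trans ?_
      rw [mul_assoc, ← Real.exp_add]
      gcongr
      have h1 : |u| ≤ |z.re + u| + |z.re| := by
        have := abs_sub (z.re + u) z.re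
        simpa using this
      nlinarith
    · filter_upwards [compl_mem_ae_iff.2 (measure_singleton 0)] with u hu
      have hu0 : u ≠ 0 := hu
      simp only [regIntegrand]
      refine Tendsto.div ?_ ?_ (by simpa using hu0)
      · refine (Complex.continuous_ofReal.tendsto _).comp (Tendsto.sub ?_ ?_)
        · exact (hcont.tendsto _).comp (hre.add_const u)
        · by_cases hI : u ∈ Set.Icc (-1 : ℝ) 1
          · simp only [Set.indicator_of_mem hI]
            exact (hcont.tendsto _).comp hre
          · simp only [Set.indicator_of_notMem hI]
            exact tendsto_const_nhds
      · exact (((Complex.continuous_ofReal.tendsto _).comp him).mul_const _).const_sub _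
  have hgx : Tendsto (fun z : ℂ => (g z.re : ℂ)) (𝓝[A] (x : ℂ)) (𝓝 (g x)) :=
    (Complex.continuous_ofReal.tendsto _).comp ((hcont.tendsto _).comp hre)
  refine (hdct.add (hgx.mul hL)).congr' ?_
  exact eventually_mem_nhdsWithin.mono fun z hz => (cauchyTransform_eq hint (hA hz)).symm

/-- From z/(s - z) = s/(s - z) - 1. Iterated, this trades each vanishing moment for one order of
decay at infinity. -/
theorem mul_cauchyTransform (hg : HolderClass g) {z : ℂ} (hz : z.im ≠ 0) :
    z * cauchyTransform g z = cauchyTransform (fun s => s * g s) z - (∫ s, g s : ℝ) := by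
  have hi : Integrable fun s : ℝ => (g s : ℂ) := hg.integrable.ofReal
  rw [cauchyTransform, cauchyTransform, ← integral_complex_ofReal, ← integral_const_mul,
    ← integral_sub (integrable_div_ofReal_sub hg.id_mul.integrable hz) hi]
  congr 1 with s
  have := ofReal_sub_ne_zero s hz
  push_cast
  field_simp
  ring

theorem pow_mul_cauchyTransform (hg : HolderClass g) (m : ℕ)
    (hm : ∀ k < m, ∫ s, s ^ k * g s = 0) {z : ℂ} (hz : z.im ≠ 0) :
    z ^ m * cauchyTransform g z = cauchyTransform (fun s => s ^ m * g s) z := by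
  induction m with
  | zero => simp
  | succ m ih =>
    rw [pow_succ', mul_assoc, ih fun k hk => hm k (hk.trans m.lt_succ_self),
      (hg.pow_mul m).mul_cauchyTransform hz, hm m m.lt_succ_self]
    simp only [pow_succ', mul_assoc, Complex.ofReal_zero, sub_zero]

theorem isBigO_cauchyTransform (hg : HolderClass g) :
    cauchyTransform g =O[offRealInfty] fun z => z⁻¹ := by
  obtain ⟨B, hB⟩ := hg.id_mul.exists_norm_cauchyTransform_le
  refine Asymptotics.IsBigO.of_bound (B + ‖((∫ s, g s : ℝ) : ℂ)‖) ?_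
  filter_upwards [mem_inf_of_right (mem_principal_self _), eventually_ne_offRealInfty 0]
    with z hz hz0
  have h1 : ‖z‖ * ‖cauchyTransform g z‖ ≤ B + ‖((∫ s, g s : ℝ) : ℂ)‖ := by
    rw [← norm_mul, hg.mul_cauchyTransform hz]
    exact (norm_sub_le _ _).trans (add_le_add (hB z hz) le_rfl)
  rw [norm_inv, ← div_eq_mul_inv, le_div_iff₀ (norm_pos_iff.2 hz0), mul_comm]
  exact h1

/-- The first nonvanishing moment gives the leading coefficient at infinity, with sign -1; the
remainder is itself a Cauchy transform. -/
theorem isBigO_pow_mul_cauchyTransform (hg : HolderClass g) (m : ℕ)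
    (hm : ∀ k < m, ∫ s, s ^ k * g s = 0) :
    (fun z => z ^ (m + 1) * cauchyTransform g z + (∫ s, s ^ m * g s : ℝ))
      =O[offRealInfty] fun z => z⁻¹ := by
  refine (hg.pow_mul (m + 1)).isBigO_cauchyTransform.congr' ?_ EventuallyEq.rfl
  filter_upwards [mem_inf_of_right (mem_principal_self _)] with z hz
  rw [pow_succ', mul_assoc, hg.pow_mul_cauchyTransform m hm hz,
    (hg.pow_mul m).mul_cauchyTransform hz, sub_add_cancel]
  simp only [pow_succ', mul_assoc]

end HolderClass

end CauchyTransform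

/-! ### Solving the Riemann-Hilbert problem. -/

section Existence

theorem expPairing_sum {V : ℝ → ℝ} {b : ℝ}
    (hb : ∀ k : ℕ, Integrable (fun x : ℝ => x ^ k * Real.exp (-V x + b * x))) {ι : Type*}
    (s : Finset ι) (γ : ι → ℝ) (p : ι → ℝ[X]) :
    expPairing V b (∑ k ∈ s, C (γ k) * p k) = ∑ k ∈ s, γ k * expPairing V b (p k) := by
  simp only [expPairing, ← integral_const_mul]
  rw [← integral_finsetSum _ fun k _ => (integrable_expPairing hb _).const_mul _]
  congr 1 with x
  simp only [eval_finsetSum, eval_mul, eval_C, Finset.sum_mul, mul_assoc]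

theorem expPairing_add {V : ℝ → ℝ} {b : ℝ}
    (hb : ∀ k : ℕ, Integrable (fun x : ℝ => x ^ k * Real.exp (-V x + b * x))) (p q : ℝ[X]) :
    expPairing V b (p + q) = expPairing V b p + expPairing V b q := by
  simp only [expPairing]
  rw [← integral_add (integrable_expPairing hb _) (integrable_expPairing hb _)]
  congr 1 with x
  rw [eval_add]; ring

theorem degree_monicOP_sub_X_pow (V : ℝ → ℝ) (k : ℕ) : (monicOP V k - X ^ k).degree < (k : WithBot ℕ) := by
  have h := degree_sub_lt_left (p := monicOP V k) (q := X ^ k)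
    (by rw [monicOP_degree, degree_X_pow]) (monicOP_monic V k).ne_zero
    (by rw [(monicOP_monic V k).leadingCoeff, leadingCoeff_X_pow])
  rwa [monicOP_degree] at h

/-- X^m and π_m differ by a combination of lower π_k, all orthogonal to q. -/
theorem ip_X_pow_of_forall_lt {V : ℝ → ℝ}
    (h : ∀ k : ℕ, Integrable (fun x : ℝ => x ^ k * Real.exp (-V x))) {q : ℝ[X]} {m : ℕ}
    (hq : ∀ k < m, ip V (monicOP V k) q = 0) : ip V (X ^ m) q = ip V (monicOP V m) q := by
  obtain ⟨γ, hγ⟩ := exists_eq_sum_monicOP V m (degree_monicOP_sub_X_pow V m)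
  have h1 : ip V q (monicOP V m - X ^ m) = 0 := by
    rw [hγ, ip_sum_right h]
    refine Finset.sum_eq_zero fun k hk => ?_
    rw [ip_C_mul_right, ip_comm, hq k (Finset.mem_range.1 hk), mul_zero]
  have h2 := ip_add_right h q (X ^ m) (monicOP V m - X ^ m)
  rw [add_sub_cancel, h1, add_zero] at h2
  rw [ip_comm, ip_comm V (monicOP V m), h2]

variable {r n : ℕ} {a : Fin r → ℝ} {V : ℝ → ℝ}

/-- Solvability of the moment problem. -/
theorem exists_poly_moments (hr : r ≤ n) (hV : Continuous V) (hmom : FiniteMoments a V)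
    (hB : IsUnit (matB n a V)) (β : ℕ → ℝ) (d : Fin r → ℝ) :
    ∃ q : ℝ[X], q.degree < n ∧ (∀ k < n - r, ip V (monicOP V k) q = β k) ∧
      ∀ j, expPairing V (a j) q = d j := by
  have hm := fun k => (hmom k).1
  set s : Fin r → ℝ := fun j => ∑ k ∈ Finset.range (n - r),
    kappaSq V k * β k * expPairing V (a j) (monicOP V k) with hs
  -- Orthogonality fixes the first n - r coefficients; the last r must then supply what remains of
  -- the exponential moments, a linear system with matrix B.
  set c : Fin r → ℝ := (d - s) ᵥ* (matB n a V)⁻¹ with hc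
  have hcB : c ᵥ* matB n a V = d - s := by
    rw [hc, Matrix.vecMul_vecMul, Matrix.nonsing_inv_mul _ ((Matrix.isUnit_iff_isUnit_det _).1 hB),
      Matrix.vecMul_one]
  set γ : ℕ → ℝ := fun k => if k < n - r then kappaSq V k * β k else
    if hk : k - (n - r) < r then c ⟨k - (n - r), hk⟩ else 0 with hγ
  have hγ1 : ∀ k < n - r, γ k = kappaSq V k * β k := fun k hk => if_pos hk
  have hγ2 : ∀ i : Fin r, γ (n - r + i) = c i := fun i => by simp [hγ]
  refine ⟨∑ k ∈ Finset.range n, C (γ k) * monicOP V k, ?_, fun k hk => ?_, fun j => ?_⟩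
  · rw [← mem_degreeLT]
    refine Submodule.sum_mem _ fun k hk => ?_
    rw [mem_degreeLT, ← smul_eq_C_mul]
    refine (degree_smul_le _ _).trans_lt ?_
    rw [monicOP_degree]
    exact_mod_cast Finset.mem_range.1 hk
  · rw [ip_monicOP_sum hV hm (by omega), hγ1 k hk]
    linear_combination β k * kappaSq_mul_ip hV hm k
  · rw [expPairing_sum fun k => (hmom k).2 j]
    conv_lhs => rw [← Nat.sub_add_cancel hr, Finset.sum_range_add]
    have h1 : ∑ k ∈ Finset.range (n - r), γ k * expPairing V (a j) (monicOP V k) = s j :=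
      Finset.sum_congr rfl fun k hk => by rw [hγ1 k (Finset.mem_range.1 hk)]
    have h2 := congrFun hcB j
    simp only [Matrix.vecMul, dotProduct, matB_apply, Pi.sub_apply] at h2
    rw [h1, Finset.sum_range]
    simp only [hγ2]
    rw [h2]
    ring

theorem integral_eval_mul_weight_succ (p : ℝ[X]) (j : Fin r) :
    ∫ s, p.eval s * weight a V j.succ s = expPairing V (a j) p := by
  rw [expPairing]
  congr 1 with s
  change _ * Real.exp (-V s + a j * s) = _
  rw [add_comm, Real.exp_add, mul_assoc]

/-- The polynomials in the first column of the solution of the Riemann-Hilbert problem. -/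
theorem exists_first_column (hr : r ≤ n) (hV : Continuous V) (hmom : FiniteMoments a V)
    (hB : IsUnit (matB n a V)) (i : Fin (r + 2)) :
    ∃ q : ℝ[X], (q - if i = 0 then X ^ n else 0).degree < (n : WithBot ℕ) ∧
      (∀ m < n - r, ∫ s, s ^ m * (q.eval s * weight a V 0 s)
        = if i = Fin.succ 0 ∧ m + 1 = n - r then 1 else 0) ∧
      ∀ j : Fin r, ∫ s, q.eval s * weight a V j.succ s = if i = j.succ.succ then 1 else 0 := by
  have hm := fun k => (hmom k).1
  -- Row 0 takes its leading term X^n from π_n, which does not disturb the prescribed pairings with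
  -- π_k for k < n - r; its exponential pairings are compensated in the data for q.
  set b : ℝ[X] := if i = 0 then monicOP V n else 0 with hb
  -- Row 1 normalises the last constrained moment, of index n - r - 1, which is the leading
  -- coefficient of its second column; there is none when n = r.
  set β : ℕ → ℝ := fun k => if i = Fin.succ 0 ∧ k + 1 = n - r then 1 else 0 with hβ
  obtain ⟨q, hq, hq0, hq1⟩ := exists_poly_moments hr hV hmom hB β
    (fun j => (if i = j.succ.succ then 1 else 0) - expPairing V (a j) b)
  have hbq : ∀ k < n - r, ip V (monicOP V k) (b + q) = β k := by
    intro k hk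
    rw [ip_add_right hm, hq0 k hk, add_eq_right, hb]
    split_ifs
    · exact ip_monicOP_of_ne hV hm (by omega)
    · simp [ip]
  refine ⟨b + q, ?_, fun m hmn => ?_, fun j => ?_⟩
  · rw [add_sub_right_comm]
    refine (degree_add_le _ _).trans_lt (max_lt ?_ hq)
    rw [hb]
    split_ifs
    · exact degree_monicOP_sub_X_pow V n
    · rw [sub_zero, degree_zero]; exact WithBot.bot_lt_coe n
  · have h1 : ∫ s, s ^ m * ((b + q).eval s * weight a V 0 s) = ip V (X ^ m) (b + q) := by
      rw [ip]
      congr 1 with s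
      rw [eval_pow, eval_X, mul_assoc]
      rfl
    rw [h1, ip_X_pow_of_forall_lt hm, hbq m hmn]
    intro k hk
    rw [hbq k (by omega), hβ]
    exact if_neg fun hc => by omega
  · rw [integral_eval_mul_weight_succ, expPairing_add fun k => (hmom k).2 j, hq1]
    ring

theorem isBigO_eval_mul_inv_pow {n : ℕ} {p : ℂ[X]} (hp : p.degree < n) :
    (fun z => p.eval z * (z ^ n)⁻¹) =O[offRealInfty] fun z => z⁻¹ := by
  have hsum : ∀ z : ℂ, p.eval z * (z ^ n)⁻¹
      = ∑ k ∈ Finset.range n, p.coeff k * (z ^ k * (z ^ n)⁻¹) := by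
    intro z
    rcases eq_or_ne p 0 with rfl | hp0
    · simp
    · rw [eval_eq_sum_range' ((natDegree_lt_iff_degree_lt hp0).2 hp), Finset.sum_mul]
      exact Finset.sum_congr rfl fun k _ => mul_assoc _ _ _
  simp only [hsum]
  refine Asymptotics.IsBigO.fun_sum fun k hk => Asymptotics.IsBigO.const_mul_left ?_ _
  obtain ⟨d, hd⟩ := Nat.exists_eq_add_of_lt (Finset.mem_range.1 hk)
  have h1 : (fun z : ℂ => z⁻¹ * (z⁻¹) ^ d) =O[offRealInfty] fun z => z⁻¹ * 1 :=
    (Asymptotics.isBigO_refl _ _).mul ((tendsto_inv_offRealInfty.pow d).isBigO_one ℂ)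
  simp only [mul_one] at h1
  refine h1.congr' ?_ EventuallyEq.rfl
  filter_upwards [eventually_ne_offRealInfty 0] with z hz
  rw [hd, add_assoc, pow_add, pow_succ', inv_pow]
  field_simp

theorem exists_isRHPSolution (hr : r ≤ n) (hV : Continuous V) (hmom : FiniteMoments a V)
    (hB : IsUnit (matB n a V)) (hdec : HolderDecay a V) :
    ∃ Z Zp Zm, IsRHPSolution n a V Z Zp Zm := by
  choose q hqd hq0 hq1 using exists_first_column hr hV hmom hB
  set g : Fin (r + 2) → Fin (r + 1) → ℝ → ℝ := fun i k s => (q i).eval s * weight a V k s with hg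
  have hgc : ∀ i k, HolderClass (g i k) := fun i k => (holderClass_weight hdec k).eval_mul (q i)
  have hpi : (2 * Real.pi * Complex.I : ℂ) ≠ 0 := by simp [Real.pi_ne_zero]
  -- Row 0 is normalised by its monic polynomial. In the other rows the diagonal entry is c / (2πi)
  -- times a Cauchy transform with leading coefficient -1, hence c = -2πi.
  set c : Fin (r + 2) → ℂ := fun i => if i = 0 then 1 else -(2 * Real.pi * Complex.I) with hc
  -- If n = r the second column has exponent 0 and must tend to a unit vector, while Cauchy
  -- transforms tend to 0. The constant is added by hand and does not affect the jump.
  set e : Fin (r + 2) → Fin (r + 1) → ℂ := fun i k =>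
    if n = r ∧ k = 0 ∧ i = k.succ then 1 else 0 with he
  set P : Fin (r + 2) → ℂ → ℂ := fun i z => ((q i).map (algebraMap ℝ ℂ)).eval z with hP
  set Z : ℂ → Matrix (Fin (r + 2)) (Fin (r + 2)) ℂ := fun z => Matrix.of fun i l =>
    Fin.cases (motive := fun _ => ℂ) (c i * P i z)
      (fun k => e i k + c i / (2 * Real.pi * Complex.I) * cauchyTransform (g i k) z) l with hZ
  set Zb : ℂ → ℝ → Matrix (Fin (r + 2)) (Fin (r + 2)) ℂ := fun L x => Matrix.of fun i l =>
    Fin.cases (motive := fun _ => ℂ) (c i * P i x)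
      (fun k => e i k + c i / (2 * Real.pi * Complex.I) *
        ((∫ u, regIntegrand (g i k) x 0 u) + g i k x * L)) l with hZb
  have hlim : ∀ (A : Set ℂ) (L : ℂ) (x : ℝ), A ⊆ {z : ℂ | z.im ≠ 0} →
      Tendsto (fun z : ℂ => logJump z.im) (𝓝[A] (x : ℂ)) (𝓝 L) →
      Tendsto Z (𝓝[A] (x : ℂ)) (𝓝 (Zb L x)) := by
    intro A L x hA hL
    refine tendsto_pi_nhds.2 fun i => tendsto_pi_nhds.2 fun l => ?_
    refine Fin.cases ?_ (fun k => ?_) l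
    · exact ((((q i).map (algebraMap ℝ ℂ)).continuous.tendsto (x : ℂ)).mono_left
        nhdsWithin_le_nhds).const_mul (c i)
    · exact (((hgc i k).tendsto_cauchyTransform hA hL).const_mul _).const_add _
  -- The columns with a negative exponent -(m + 1): the moments below m vanish, and the m-th is 1 on
  -- the diagonal and 0 off it.
  have hone : ∀ i k, k ≠ 0 ∨ n ≠ r →
      (fun z => (e i k + c i / (2 * Real.pi * Complex.I) * cauchyTransform (g i k) z)
        * z ^ (-rhpExponent n r k.succ)
        - (1 : Matrix (Fin (r + 2)) (Fin (r + 2)) ℂ) i k.succ) =O[offRealInfty] fun z => z⁻¹ := by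
    intro i k hk
    obtain ⟨m, hme, hm0, hm1⟩ : ∃ m : ℕ, -rhpExponent n r k.succ = ((m + 1 : ℕ) : ℤ) ∧
        (∀ l < m, ∫ s, s ^ l * g i k s = 0) ∧
        ∫ s, s ^ m * g i k s = if i = k.succ then 1 else 0 := by
      induction k using Fin.cases with
      | zero =>
        have hnr : r < n := lt_of_le_of_ne hr (hk.resolve_left (by simp)).symm
        refine ⟨n - r - 1, ?_, fun l hl => ?_, ?_⟩
        · change -(-(n : ℤ) + r) = _
          omega
        · rw [hg, hq0 i l (by omega)]
          exact if_neg fun h => by omega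
        · rw [hg, hq0 i (n - r - 1) (by omega)]
          exact if_congr (and_iff_left (by omega)) rfl rfl
      | succ j =>
        refine ⟨0, ?_, fun l hl => absurd hl l.not_lt_zero, ?_⟩
        · change -(-1 : ℤ) = _
          norm_num
        · simp only [pow_zero, one_mul]
          exact hq1 i j
    have he0 : e i k = 0 := if_neg fun h => by
      rcases hk with hk | hk
      · exact hk h.2.1
      · exact hk h.1
    refine (((hgc i k).isBigO_pow_mul_cauchyTransform m hm0).const_mul_left
      (c i / (2 * Real.pi * Complex.I))).congr_left fun z => ?_
    rw [he0, hme, zpow_natCast, hm1, zero_add, mul_add, Matrix.one_apply]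
    have h1 : c i / (2 * Real.pi * Complex.I) * ((if i = k.succ then 1 else 0 : ℝ) : ℂ)
        = -(if i = k.succ then 1 else 0) := by
      split_ifs with h
      · have hi0 : i ≠ 0 := by rw [h]; exact Fin.succ_ne_zero k
        simp only [hc, if_neg hi0, Complex.ofReal_one, mul_one, neg_div, div_self hpi]
      · simp
    rw [h1]
    ring
  refine ⟨Z, Zb (Real.pi * Complex.I), Zb (-(Real.pi * Complex.I)), ?_, fun x => ?_, fun x => ?_,
    fun x => ?_, fun i l => ?_⟩
  · intro i l
    refine Fin.cases ?_ (fun k => ?_) l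
    · exact (((q i).map (algebraMap ℝ ℂ)).differentiable.differentiableOn).const_mul (c i)
    · exact ((differentiableOn_cauchyTransform (hgc i k).integrable).const_mul _).const_add _
  · exact hlim _ _ x (fun z hz => ne_of_gt hz) (tendsto_logJump_upper x)
  · exact hlim _ _ x (fun z hz => ne_of_lt hz) (tendsto_logJump_lower x)
  · ext i l
    refine Fin.cases ?_ (fun k => ?_) l
    · rw [mul_jumpMatrix_zero]; rfl
    · rw [mul_jumpMatrix_succ]
      have hgx : (g i k x : ℂ) = P i x * weight a V k x := by
        simp only [hg, hP, eval_map_ofReal]; push_cast; rfl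
      simp only [hZb, Matrix.of_apply, Fin.cases_succ, Fin.cases_zero, hgx]
      field_simp
      ring
  · simp only [Matrix.mul_diagonal]
    refine Fin.cases ?_ (fun k => ?_) l
    · have h1 : ((q i - if i = 0 then X ^ n else 0).map (algebraMap ℝ ℂ)).degree < (n : WithBot ℕ) :=
        degree_map_le.trans_lt (hqd i)
      refine ((isBigO_eval_mul_inv_pow h1).const_mul_left (c i)).congr' ?_ EventuallyEq.rfl
      filter_upwards [eventually_ne_offRealInfty 0] with z hz
      have h2 : -rhpExponent n r 0 = -(n : ℤ) := rfl
      have h3 : z ^ n ≠ 0 := pow_ne_zero _ hz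
      simp only [hZ, Matrix.of_apply, Fin.cases_zero, h2, _root_.zpow_neg, zpow_natCast,
        Polynomial.map_sub, eval_sub, hP]
      by_cases hi : i = 0
      · subst hi
        simp only [hc, if_true, one_mul, Matrix.one_apply_eq, Polynomial.map_pow, map_X,
          eval_pow, eval_X]
        field_simp
      · simp only [if_neg hi, Polynomial.map_zero, eval_zero, sub_zero, Matrix.one_apply_ne hi]
        ring
    · simp only [hZ, Matrix.of_apply, Fin.cases_succ]
      by_cases hk : k ≠ 0 ∨ n ≠ r
      · exact hone i k hk
      · push Not at hk
        obtain ⟨rfl, hnr⟩ := hk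
        have h2 : -rhpExponent n r (Fin.succ 0) = 0 := by
          change -(-(n : ℤ) + r) = 0
          omega
        refine ((hgc i 0).isBigO_cauchyTransform.const_mul_left
          (c i / (2 * Real.pi * Complex.I))).congr_left fun z => ?_
        have h3 : e i 0 = (1 : Matrix (Fin (r + 2)) (Fin (r + 2)) ℂ) i (Fin.succ 0) := by
          rw [Matrix.one_apply, he]
          exact if_congr ⟨fun h => h.2.2, fun h => ⟨hnr, rfl, h⟩⟩ rfl rfl
        rw [h2, zpow_zero, mul_one, h3]
        ring

end Existence

end ExternalSource

/-! ### The main theorem. -/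

theorem theorem1 {r : ℕ} (n : ℕ) (hn : 1 ≤ n) (hr : r ≤ n)
    (a : Fin r → ℝ) (ha : Function.Injective a) (ha0 : ∀ j, a j ≠ 0)
    (V : ℝ → ℝ) (hV : Continuous V) (hmom : ExternalSource.FiniteMoments a V) :
    -- the matrix `B` is invertible
    IsUnit (ExternalSource.matB n a V) ∧
    -- the Riemann-Hilbert problem has a solution, for a weight that is regular enough
    (ExternalSource.HolderDecay a V →
      ∃ Z Zp Zm, ExternalSource.IsRHPSolution n a V Z Zp Zm) ∧
    -- the formula, for every solution and every choice of its boundary values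
    (∀ Z Zp Zm, ExternalSource.IsRHPSolution n a V Z Zp Zm →
      ∀ P Q, (P = Zp ∨ P = Zm) → (Q = Zp ∨ Q = Zm) →
        (∀ x y : ℝ, x ≠ y →
          (ExternalSource.kernel a V P Q x y - (ExternalSource.kernelZero n V x y : ℂ)) *
              (Real.exp (V x) : ℂ)
            = ((ExternalSource.wVec n a V y ⬝ᵥ
                ((ExternalSource.matB n a V)⁻¹ *ᵥ ExternalSource.tVec n r V x) : ℝ) : ℂ)) ∧
        -- on the diagonal both kernels are defined by continuity
        ∀ y : ℝ, ∃ (k : ℂ) (k₀ : ℝ),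
          Tendsto (fun p : ℝ × ℝ => ExternalSource.kernel a V P Q p.1 p.2)
            (𝓝[{p : ℝ × ℝ | p.1 ≠ p.2}] (y, y)) (𝓝 k) ∧
          Tendsto (fun p : ℝ × ℝ => ExternalSource.kernelZero n V p.1 p.2)
            (𝓝[{p : ℝ × ℝ | p.1 ≠ p.2}] (y, y)) (𝓝 k₀) ∧
          (k - (k₀ : ℂ)) * (Real.exp (V y) : ℂ)
            = ((ExternalSource.wVec n a V y ⬝ᵥ
                ((ExternalSource.matB n a V)⁻¹ *ᵥ ExternalSource.tVec n r V y) : ℝ) : ℂ)) := by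
  have hB := ExternalSource.isUnit_matB hr ha ha0 hV hmom
  refine ⟨hB, ExternalSource.exists_isRHPSolution hr hV hmom hB, ?_⟩
  intro Z Zp Zm hZ P Q hP hQ
  have hm := fun k => (hmom k).1
  -- The right side makes sense and is jointly continuous also at x = y, as is the
  -- Christoffel-Darboux sum for K₀; these furnish the diagonal limits.
  have hK : ∀ x y : ℝ, x ≠ y → ExternalSource.kernel a V P Q x y
      = ((Real.exp (-V x) * (ExternalSource.cdKernel n V x y + ExternalSource.wVec n a V y ⬝ᵥ
        ((ExternalSource.matB n a V)⁻¹ *ᵥ ExternalSource.tVec n r V x)) : ℝ) : ℂ) := by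
    intro x y hxy
    rw [hZ.kernel_eq hr hV hmom hB hP hQ hxy, ExternalSource.complexKernel_ofReal hn hV hmom,
      Complex.ofReal_mul]
  have hexp : ∀ x, Real.exp (-V x) * Real.exp (V x) = 1 := fun x => by
    rw [← Real.exp_add]; simp
  have hid : ∀ c w x : ℝ, (((Real.exp (-V x) * (c + w) : ℝ) : ℂ) - ((Real.exp (-V x) * c : ℝ) : ℂ))
      * (Real.exp (V x) : ℂ) = (w : ℂ) := by
    intro c w x
    have : (Real.exp (-V x) * (c + w) - Real.exp (-V x) * c) * Real.exp (V x) = w := by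
      linear_combination w * hexp x
    exact_mod_cast this
  refine ⟨fun x y hxy => ?_, fun y => ?_⟩
  · rw [hK x y hxy, ExternalSource.kernelZero_eq hV hm hn hxy]
    exact hid _ _ x
  · have hcd : Continuous fun p : ℝ × ℝ => Real.exp (-V p.1)
        * ExternalSource.cdKernel n V p.1 p.2 := by
      unfold ExternalSource.cdKernel
      fun_prop
    have hwv : Continuous fun y => ExternalSource.wVec n a V y := by
      refine continuous_pi fun j => ?_
      simp only [ExternalSource.wVec_eq hn hV hmom]
      fun_prop
    have htv : Continuous fun x => ExternalSource.tVec n r V x := by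
      refine continuous_pi fun i => ?_
      unfold ExternalSource.tVec
      fun_prop
    have hw : Continuous fun p : ℝ × ℝ => Real.exp (-V p.1)
        * (ExternalSource.wVec n a V p.2 ⬝ᵥ
          ((ExternalSource.matB n a V)⁻¹ *ᵥ ExternalSource.tVec n r V p.1)) :=
      (by fun_prop : Continuous fun p : ℝ × ℝ => Real.exp (-V p.1)).mul
        ((hwv.comp continuous_snd).dotProduct
          (continuous_const.matrix_mulVec (htv.comp continuous_fst)))
    have hKc : Continuous fun p : ℝ × ℝ => ((Real.exp (-V p.1) *
        (ExternalSource.cdKernel n V p.1 p.2 + ExternalSource.wVec n a V p.2 ⬝ᵥ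
          ((ExternalSource.matB n a V)⁻¹ *ᵥ ExternalSource.tVec n r V p.1)) : ℝ) : ℂ) := by
      simp only [mul_add]
      exact Complex.continuous_ofReal.comp (hcd.add hw)
    refine ⟨_, _, ((hKc.tendsto (y, y)).mono_left nhdsWithin_le_nhds).congr' ?_,
      ((hcd.tendsto (y, y)).mono_left nhdsWithin_le_nhds).congr' ?_, ?_⟩
    · exact eventually_mem_nhdsWithin.mono fun p hp => (hK p.1 p.2 hp).symm
    · exact eventually_mem_nhdsWithin.mono fun p hp =>
        (ExternalSource.kernelZero_eq hV hm hn hp).symm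
    · exact hid _ _ y
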